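/- Graphs are connected, locally finite and undirected, with at least one edge; multiple edges and loops are allowed. The simple random walk on a graph $X$ moves from $y$ to $z$ with probability $p(y,z)=\#\{\text{edges joining } y \text{ and } z\}/\deg(y)$, where a loop is counted once in $\deg(y)$; $p^n(y,z)$ denotes its $n$-step transition probability, $d$ the graph distance, and $B_r(y)$ the set of vertices at distance at most $r$ from $y$. A random rooted graph $(X,x)$ is a random element of the space of isomorphism classes of rooted graphs with the Borel $\sigma$-algebra of the local topology (convergence means that, for each radius, the ball around the root is eventually isomorphic to the ball of the limit). The simple random walk on it is the random isomorphism class of a graph with a path, $(X,x,(x_0,x_1,\ldots))$, such that the conditional distribution of $(x_0,x_1,\ldots)$ given $(X,x)$ is that of the simple random walk on $X$ with $x_0=x$. The random graph is stationary if $(X,x_1)$ has the same distribution as $(X,x)$; a stationary random graph is ergodic if the distribution of the simple random walk on it is an ergodic invariant measure for the shift $(X,x,(x_0,x_1,x_2,\ldots))\mapsto(X,x_1,(x_1,x_2,\ldots))$. Let $(X,x)$ be an ergodic stationary random graph such that $$v(X,x)=\liminf_{r\to+\infty} r^{-1}\,\mathbb{E}\bigl(\log|B_r(x)|\bigr)<+\infty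 .$$ Then the linear drift $\ell(X,x)=\lim_{n\to+\infty} \frac1n d(x_0,x_n)$ and the entropy $h(X,x)=\lim_{n\to+\infty}-\frac1n\log p^n(x_0,x_n)$ exist as finite constants, both limits being almost sure and in mean, and $$\tfrac12\,\ell(X,x)^2\le h(X,x)\le \ell(X,x)\,v(X,x).$$ -/

import Mathlib

open MeasureTheory ProbabilityTheory Filter Topology
open scoped ENNReal

noncomputable section

namespace RandomGraph

/-- A connected locally finite undirected graph; multiple edges and loops are allowed, and
`mult x y` is the number of edges joining `x` and `y` (each loop is counted once). As far as
isomorphism classes and random walks on vertices are concerned, a multigraph is the same as its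
multiplicity function. Such a graph is countable, so vertex types in `Type` suffice. The field
`pos` only excludes the graph with a single vertex and no edge, on which there is no walk. -/
structure Graph : Type 1 where
  V : Type
  mult : V → V → ℕ
  symm : ∀ x y, mult x y = mult y x
  locFin : ∀ x, {y | 0 < mult x y}.Finite
  pos : ∀ x, ∃ y, 0 < mult x y
  conn : ∀ x y, Relation.ReflTransGen (fun a b => 0 < mult a b) x y

namespace Graph

variable (G : Graph)

/-- The underlying simple graph, which carries the graph distance. -/
def simple : SimpleGraph G.V where
  Adj x y := x ≠ y ∧ 0 < G.mult x y
  symm := ⟨fun x y h => ⟨h.1.symm, by rw [G.symm y x]; exact h.2⟩⟩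
  loopless := ⟨fun _ h => h.1 rfl⟩

/-- The graph distance. -/
def dist (x y : G.V) : ℕ := G.simple.dist x y

/-- The set of vertices at distance `r` or less from `x`. -/
def ball (x : G.V) (r : ℕ) : Set G.V := {y | G.dist x y ≤ r}

/-- The degree; each loop is counted once. -/
def deg (x : G.V) : ℕ := ∑ᶠ y, G.mult x y

/-- The one step transition probability. -/
def p (x y : G.V) : ℝ := (G.mult x y : ℝ) / (G.deg x : ℝ)

open Classical in
/-- The `n`-th step transition probability. The sums have finitely many nonzero terms. -/
def pn : ℕ → G.V → G.V → ℝ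
  | 0, x, y => if x = y then 1 else 0
  | n + 1, x, y => ∑' z, G.p x z * pn n z y

instance : MeasurableSpace G.V := ⊤

instance : DiscreteMeasurableSpace G.V := ⟨fun _ => trivial⟩

lemma tsum_mult (x : G.V) : ∑' y, (G.mult x y : ℝ≥0∞) = (G.deg x : ℝ≥0∞) := by
  have hs : (Function.support (G.mult x)) ⊆ ((G.locFin x).toFinset : Set G.V) := by
    intro y hy
    simpa [Nat.pos_iff_ne_zero] using hy
  rw [deg, finsum_eq_sum_of_support_subset _ hs, tsum_eq_sum (s := (G.locFin x).toFinset)]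
  · push_cast; rfl
  · intro y hy
    simpa using hy

lemma deg_pos (x : G.V) : 0 < G.deg x := by
  obtain ⟨y, hy⟩ := G.pos x
  have h := ENNReal.le_tsum (f := fun y => (G.mult x y : ℝ≥0∞)) y
  rw [tsum_mult] at h
  exact lt_of_lt_of_le hy (by exact_mod_cast h)

/-- The distribution `p(x, ·)` of the vertex reached by one step from `x`. -/
def step (x : G.V) : PMF G.V :=
  PMF.normalize (fun y => (G.mult x y : ℝ≥0∞))
    (by rw [tsum_mult]; exact_mod_cast (G.deg_pos x).ne')
    (by rw [tsum_mult]; exact ENNReal.natCast_ne_top _)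

lemma step_apply (x y : G.V) : G.step x y = ENNReal.ofReal (G.p x y) := by
  have hd : (0 : ℝ) < G.deg x := by exact_mod_cast G.deg_pos x
  rw [step, PMF.normalize_apply, tsum_mult, p, ENNReal.ofReal_div_of_pos hd,
    ENNReal.ofReal_natCast, ENNReal.ofReal_natCast, div_eq_mul_inv]

/-- The Markov kernel of the simple random walk, as a function of the path so far. -/
def stepKernel (n : ℕ) : Kernel (∀ _ : Finset.Iic n, G.V) G.V :=
  Kernel.comap (⟨fun x => (G.step x).toMeasure, measurable_from_top⟩ : Kernel G.V G.V)
    (fun h => h ⟨n, Finset.mem_Iic.2 le_rfl⟩) (measurable_pi_apply _)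

instance (n : ℕ) : IsMarkovKernel (G.stepKernel n) :=
  ⟨fun h => by
    change IsProbabilityMeasure (G.step (h ⟨n, Finset.mem_Iic.2 le_rfl⟩)).toMeasure
    infer_instance⟩

/-- The space of paths: sequences of vertices in which consecutive vertices are neighbors. -/
def PathSpace : Type := {ω : ℕ → G.V // ∀ n, 0 < G.mult (ω n) (ω (n + 1))}

instance : MeasurableSpace G.PathSpace :=
  MeasurableSpace.comap (fun ω : G.PathSpace => (ω.1 : ℕ → G.V)) inferInstance

/-- The distribution of the simple random walk starting at `x`, on all sequences of vertices. -/
def seqLaw (x : G.V) : Measure (ℕ → G.V) :=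
  Kernel.traj (X := fun _ => G.V) G.stepKernel 0 (fun _ => x)

/-- The distribution of the simple random walk starting at `x`, on the path space. -/
def walkLaw (x : G.V) : Measure G.PathSpace :=
  (G.seqLaw x).comap (fun ω : G.PathSpace => (ω.1 : ℕ → G.V))

end Graph

/-- A rooted graph. -/
structure RootedGraph : Type 1 extends Graph where
  root : V

/-- A graph with a path; the root is the starting point of the path. -/
structure PathGraph : Type 1 where
  G : Graph
  path : G.PathSpace

namespace RootedGraph

/-- Isomorphism of rooted graphs. -/
instance setoid : Setoid RootedGraph where
  r X Y := ∃ e : X.V ≃ Y.V, (∀ x y, Y.mult (e x) (e y) = X.mult x y) ∧ e X.root = Y.root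
  iseqv :=
    ⟨fun X => ⟨Equiv.refl _, fun _ _ => rfl, rfl⟩,
     fun {X Y} ⟨e, h, hr⟩ => ⟨e.symm, fun x y => by rw [← h]; simp, by simp [← hr]⟩,
     fun {X Y Z} ⟨e, h, hr⟩ ⟨f, k, kr⟩ =>
      ⟨e.trans f, fun x y => by simp [h, k], by simp [hr, kr]⟩⟩

/-- The balls of radius `r` around the roots are isomorphic as rooted graphs. -/
def BallIso (r : ℕ) (X Y : RootedGraph) : Prop :=
  ∃ e : X.ball X.root r ≃ Y.ball Y.root r,
    (∀ x y : X.ball X.root r, Y.mult (e x) (e y) = X.mult x y) ∧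
    ∀ x : X.ball X.root r, (x : X.V) = X.root ↔ (e x : Y.V) = Y.root

end RootedGraph

namespace PathGraph

/-- The vertex visited at time `n`. -/
def at_ (X : PathGraph) (n : ℕ) : X.G.V := X.path.1 n

/-- Forget the path, keep its starting point as the root. -/
def rooted (X : PathGraph) : RootedGraph := { X.G with root := X.at_ 0 }

/-- The shift `(X, x, (x₀, x₁, …)) ↦ (X, x₁, (x₁, x₂, …))`. -/
def shift (X : PathGraph) : PathGraph := ⟨X.G, ⟨fun n => X.at_ (n + 1), fun n => X.path.2 (n + 1)⟩⟩

/-- Isomorphism of graphs with a path. -/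
instance setoid : Setoid PathGraph where
  r X Y := ∃ e : X.G.V ≃ Y.G.V,
    (∀ x y, Y.G.mult (e x) (e y) = X.G.mult x y) ∧ ∀ n, e (X.at_ n) = Y.at_ n
  iseqv :=
    ⟨fun X => ⟨Equiv.refl _, fun _ _ => rfl, fun _ => rfl⟩,
     fun {X Y} ⟨e, h, hr⟩ => ⟨e.symm, fun x y => by rw [← h]; simp, fun n => by simp [← hr]⟩,
     fun {X Y Z} ⟨e, h, hr⟩ ⟨f, k, kr⟩ =>
      ⟨e.trans f, fun x y => by simp [h, k], fun n => by simp [hr, kr]⟩⟩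

/-- The balls of radius `r` around the roots, together with the first `r` steps of the paths
(which stay in these balls), are isomorphic. -/
def BallIso (r : ℕ) (X Y : PathGraph) : Prop :=
  ∃ e : X.G.ball (X.at_ 0) r ≃ Y.G.ball (Y.at_ 0) r,
    (∀ x y : X.G.ball (X.at_ 0) r, Y.G.mult (e x) (e y) = X.G.mult x y) ∧
    ∀ i ≤ r, ∀ x : X.G.ball (X.at_ 0) r, (x : X.G.V) = X.at_ i ↔ (e x : Y.G.V) = Y.at_ i

end PathGraph

/-- The space of isomorphism classes of rooted graphs. -/
def RootedClass : Type 1 := Quotient RootedGraph.setoid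

/-- The space of isomorphism classes of graphs with a path. -/
def PathClass : Type 1 := Quotient PathGraph.setoid

/-- The local topology: two classes are close if large balls around the roots are isomorphic. -/
instance : TopologicalSpace RootedClass :=
  TopologicalSpace.generateFrom
    {U | ∃ (X : RootedGraph) (r : ℕ),
      U = (fun Y => (Quotient.mk RootedGraph.setoid Y : RootedClass)) '' {Y | X.BallIso r Y}}

instance : MeasurableSpace RootedClass := borel _

instance : BorelSpace RootedClass := ⟨rfl⟩

instance : TopologicalSpace PathClass :=
  TopologicalSpace.generateFrom
    {U | ∃ (X : PathGraph) (r : ℕ),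
      U = (fun Y => (Quotient.mk PathGraph.setoid Y : PathClass)) '' {Y | X.BallIso r Y}}

instance : MeasurableSpace PathClass := borel _

instance : BorelSpace PathClass := ⟨rfl⟩

/-! Distances, balls and transition probabilities are invariant under isomorphism. -/

lemma dist_le_of_hom {G H : Graph} (e : G.V → H.V) (he : Function.Injective e)
    (h : ∀ x y, H.mult (e x) (e y) = G.mult x y) (x y : G.V)
    (hxy : G.simple.Reachable x y) : H.dist (e x) (e y) ≤ G.dist x y := by
  let f : G.simple →g H.simple := ⟨e, fun {a b} hab => ⟨he.ne hab.1, by rw [h]; exact hab.2⟩⟩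
  obtain ⟨w, hw⟩ := hxy.exists_walk_length_eq_dist
  have := SimpleGraph.dist_le (w.map f)
  rw [SimpleGraph.Walk.length_map, hw] at this
  exact this

lemma Graph.reachable (G : Graph) (x y : G.V) : G.simple.Reachable x y := by
  have h := G.conn x y
  induction h with
  | refl => exact SimpleGraph.Reachable.refl _
  | @tail b c _ hbc ih =>
    by_cases hb : b = c
    · exact hb ▸ ih
    · exact ih.trans (SimpleGraph.Adj.reachable (⟨hb, hbc⟩ : G.simple.Adj b c))

lemma dist_iso {G H : Graph} (e : G.V ≃ H.V) (h : ∀ x y, H.mult (e x) (e y) = G.mult x y)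
    (x y : G.V) : H.dist (e x) (e y) = G.dist x y := by
  refine le_antisymm (dist_le_of_hom e e.injective h x y (G.reachable x y)) ?_
  have := dist_le_of_hom e.symm e.symm.injective (fun x y => by rw [← h]; simp) (e x) (e y)
    (H.reachable _ _)
  simpa using this

lemma ball_iso {G H : Graph} (e : G.V ≃ H.V) (h : ∀ x y, H.mult (e x) (e y) = G.mult x y)
    (x : G.V) (r : ℕ) : H.ball (e x) r = e '' G.ball x r := by
  ext y
  obtain ⟨z, rfl⟩ := e.surjective y
  simp [Graph.ball, dist_iso e h]

lemma p_iso {G H : Graph} (e : G.V ≃ H.V) (h : ∀ x y, H.mult (e x) (e y) = G.mult x y)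
    (x y : G.V) : H.p (e x) (e y) = G.p x y := by
  have hd : H.deg (e x) = G.deg x := by
    unfold Graph.deg
    rw [← finsum_comp_equiv e]
    simp [h]
  rw [Graph.p, Graph.p, h, hd]

lemma pn_iso {G H : Graph} (e : G.V ≃ H.V) (h : ∀ x y, H.mult (e x) (e y) = G.mult x y)
    (n : ℕ) (x y : G.V) : H.pn n (e x) (e y) = G.pn n x y := by
  induction n generalizing x with
  | zero =>
    by_cases hxy : x = y
    · simp [Graph.pn, hxy]
    · simp [Graph.pn, hxy, e.injective.ne hxy]
  | succ n ih =>
    rw [Graph.pn, Graph.pn, ← e.tsum_eq]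
    exact tsum_congr fun z => by rw [p_iso e h, ih]

namespace RootedClass

/-- The number `|B_r(x)|` of vertices at distance `r` or less from the root. -/
def ballCard (r : ℕ) : RootedClass → ℕ :=
  Quotient.lift (fun X : RootedGraph => (X.ball X.root r).ncard) (by
    rintro X Y ⟨e, h, hr⟩
    rw [← hr, ball_iso e h, Set.ncard_image_of_injective _ e.injective])

end RootedClass

namespace PathClass

/-- Forget the path, keep its starting point as the root. -/
def rooted : PathClass → RootedClass :=
  Quotient.map PathGraph.rooted (by
    rintro X Y ⟨e, h, hp⟩
    exact ⟨e, h, hp 0⟩)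

/-- The shift `(X, x, (x₀, x₁, …)) ↦ (X, x₁, (x₁, x₂, …))`. -/
def shift : PathClass → PathClass :=
  Quotient.map PathGraph.shift (by
    rintro X Y ⟨e, h, hp⟩
    exact ⟨e, h, fun n => hp (n + 1)⟩)

/-- The distance `d(x₀, x_n)`. -/
def distAt (n : ℕ) : PathClass → ℕ :=
  Quotient.lift (fun X : PathGraph => X.G.dist (X.at_ 0) (X.at_ n)) (by
    rintro X Y ⟨e, h, hp⟩
    rw [← hp, ← hp, dist_iso e h])

/-- The transition probability `p^n(x₀, x_n)`. -/
def pAt (n : ℕ) : PathClass → ℝ :=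
  Quotient.lift (fun X : PathGraph => X.G.pn n (X.at_ 0) (X.at_ n)) (by
    rintro X Y ⟨e, h, hp⟩
    rw [← hp, ← hp, pn_iso e h])

end PathClass

/-- The distribution of the simple random walk started at the root of a fixed rooted graph, as a
measure on isomorphism classes (it does not depend on the chosen representative). -/
def classWalkLaw (g : RootedClass) : Measure PathClass :=
  let X : RootedGraph := Quotient.out g
  (X.toGraph.walkLaw X.root).map
    (fun ω => (Quotient.mk PathGraph.setoid ⟨X.toGraph, ω⟩ : PathClass))

/-- The distribution of the simple random walk on the random rooted graph with law `μ`: the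
conditional distribution of the path given the rooted graph is that of the simple random walk
starting at the root. -/
def walkLaw (μ : Measure RootedClass) : Measure PathClass := μ.bind classWalkLaw

/-- `(X, x)` has the same distribution as `(X, x₁)`. -/
def IsStationary (μ : Measure RootedClass) : Prop :=
  (walkLaw μ).map (fun w => w.shift.rooted) = μ

/-- A stationary random graph is ergodic if the distribution of the simple random walk on it is
an ergodic invariant measure for the shift. -/
structure IsErgodicStationary (μ : Measure RootedClass) : Prop where
  stationary : IsStationary μ
  ergodic : Ergodic PathClass.shift (walkLaw μ)

/-- The volume growth `v(X, x) = liminf r⁻¹ 𝔼 log |B_r(x)|`. -/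
def volumeGrowth (μ : Measure RootedClass) : ℝ≥0∞ :=
  liminf (fun r : ℕ => (∫⁻ g, ENNReal.ofReal (Real.log (g.ballCard r)) ∂μ) / (r : ℝ≥0∞)) atTop

/-- The constant `c` is the limit of the random variables `f n`, almost surely and in mean. -/
def IsLimitASMean {Ω : Type*} [MeasurableSpace Ω] (ν : Measure Ω) (f : ℕ → Ω → ℝ) (c : ℝ) :
    Prop :=
  (∀ᵐ w ∂ν, Tendsto (fun n => f n w) atTop (𝓝 c)) ∧
    Tendsto (fun n => ∫⁻ w, ENNReal.ofReal |f n w - c| ∂ν) atTop (𝓝 0)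

/-- `ℓ` is the linear drift: the limit of `d(x₀, x_n) / n`. -/
def IsLinearDrift (μ : Measure RootedClass) (l : ℝ) : Prop :=
  IsLimitASMean (walkLaw μ) (fun n w => (w.distAt n : ℝ) / n) l

/-- `h` is the entropy: the limit of `-log p^n(x₀, x_n) / n`. -/
def IsEntropy (μ : Measure RootedClass) (h : ℝ) : Prop :=
  IsLimitASMean (walkLaw μ) (fun n w => -Real.log (w.pAt n) / n) h

end RandomGraph

end

/-! Both d(x₀, xₙ) and -log pⁿ(x₀, xₙ) are nonnegative subadditive cocycles over the shift, the
second one because going from x₀ to x_{m+n} through x_m is one way of doing it. The first step has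
distance at most 1, and 𝔼(-log p(x₀, x₁)) ≤ 𝔼 log |B₁(x)| by Gibbs' inequality, which is finite
because v is. Kingman's theorem (`exists_tendsto_subadditive`, proved here by greedily cutting
orbits into blocks) gives constant limits, almost surely and in mean.

Lower bound on h: the Varopoulos-Carne bound (`pn_le_varopoulos_carne`) says pⁿ(x₀, xₙ) ≤ 2 √(deg xₙ
/ deg x₀) exp(-d(x₀, xₙ)² / 2n). Take logarithms and divide by n. No moment of the degree is needed:
by stationarity deg xₙ is distributed as deg x₀, so (log deg xₙ)/n tends to 0 in probability.

Upper bound on h: let c < h. For large n, with probability close to 1, the walk is at distance at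
most r = (ℓ+ε)n, at a point where pⁿ ≤ exp(-cn). In a graph where |B_r| < exp(cn)/2 this event has
conditional probability at most 1/2, so for most graphs |B_r| ≥ exp(cn)/2. Hence 𝔼 log |B_r| is at
least nearly cn (`two_mul_walkLaw_le`), and dividing by r gives h ≤ ℓv in the limit. -/

noncomputable section

/-! ### Kingman's subadditive ergodic theorem over an ergodic transformation. -/

namespace ErgodicTheory

variable {Ω : Type*} {T : Ω → Ω}

/-- Pathwise estimate for a subadditive cocycle `F` which, outside of the set `A`, is
nonpositive at some time between `1` and `N`. -/
lemma subadditive_le_of_greedy {F : ℕ → Ω → ℝ} {b : Ω → ℝ} {A : Set Ω} {N : ℕ}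
    (hF0 : ∀ w, F 0 w ≤ 0) (hF1 : ∀ w, F 1 w ≤ b w) (hb : ∀ w, 0 ≤ b w)
    (hF : ∀ m n w, F (m + n) w ≤ F m w + F n (T^[m] w))
    (hA : ∀ w ∉ A, ∃ k, 1 ≤ k ∧ k ≤ N ∧ F k w ≤ 0) (n : ℕ) (w : Ω) :
    F n w ≤ birkhoffSum T (A.indicator b) n w
      + (birkhoffSum T b n w - birkhoffSum T b (n - N) w) := by
  have hSnn : ∀ n w, 0 ≤ birkhoffSum T b n w := fun n w =>
    Finset.sum_nonneg fun i _ => hb _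
  have hInn : ∀ w, 0 ≤ A.indicator b w := fun w => Set.indicator_nonneg (fun _ _ => hb _) _
  have hInd : ∀ n w, 0 ≤ birkhoffSum T (A.indicator b) n w := fun n w =>
    Finset.sum_nonneg fun i _ => hInn _
  have hle : ∀ n w, F n w ≤ birkhoffSum T b n w := by
    intro n
    induction n with
    | zero => intro w; simpa using hF0 w
    | succ n ih =>
      intro w
      rw [add_comm n 1, birkhoffSum_add]
      have := hF 1 n w
      have h1 := hF1 w
      have h2 := ih (T^[1] w)
      simp only [birkhoffSum_one] at *
      linarith
  induction n using Nat.strong_induction_on generalizing w with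
  | _ n ih =>
    -- Up to time `N` the boundary term is the whole Birkhoff sum of `b`.
    rcases le_or_gt n N with hn | hn
    · rw [Nat.sub_eq_zero_of_le hn, birkhoffSum_zero]
      linarith [hle n w, hInd n w]
    -- Greedy choice of the first block: in `A` a single step, paid by `b`; outside of `A` a block
    -- of length at most `N` which costs nothing.
    · obtain ⟨k, hk1, hkn, hk⟩ : ∃ k, 1 ≤ k ∧ k ≤ n ∧
          F k w ≤ birkhoffSum T (A.indicator b) k w := by
        by_cases hw : w ∈ A
        · refine ⟨1, le_rfl, by omega, ?_⟩
          simpa [hw] using hF1 w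
        · obtain ⟨k, h1, h2, h3⟩ := hA w hw
          exact ⟨k, h1, by omega, h3.trans (hInd k w)⟩
      have e1 := hF k (n - k) w
      have e2 := ih (n - k) (by omega) (T^[k] w)
      have e3 := birkhoffSum_add T (A.indicator b) k (n - k) w
      have e4 := birkhoffSum_add T b k (n - k) w
      rw [Nat.add_sub_cancel' hkn] at e1 e3 e4
      -- An equality if the block ends before `n - N`; otherwise the last sum is empty and `b ≥ 0`
      -- suffices.
      have e5 : birkhoffSum T b (n - N) w
          ≤ birkhoffSum T b k w + birkhoffSum T b (n - k - N) (T^[k] w) := by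
        rcases le_or_gt k (n - N) with h | h
        · have := birkhoffSum_add T b k (n - N - k) w
          rw [Nat.add_sub_cancel' h] at this
          rw [this, Nat.sub_right_comm]
        · have h' : birkhoffSum T b (n - N) w ≤ birkhoffSum T b k w :=
            Finset.sum_le_sum_of_subset_of_nonneg
              (Finset.range_subset_range.2 h.le) fun _ _ _ => hb _
          linarith [hSnn (n - k - N) (T^[k] w)]
      linarith

lemma tendsto_ofReal_div_nat_succ (x : ℝ) :
    Tendsto (fun n : ℕ => ENNReal.ofReal (x / ((n + 1 : ℕ) : ℝ))) atTop (𝓝 0) := by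
  have h := ((tendsto_const_div_atTop_nhds_zero_nat x).comp (tendsto_add_atTop_nat 1))
  simpa using ENNReal.tendsto_ofReal h

lemma ofReal_div_succ_le {f : ℕ → Ω → ℝ} (hf : ∀ n w, 0 ≤ f n w)
    (hsub : ∀ m n w, f (m + n) w ≤ f m w + f n (T^[m] w)) (n : ℕ) (w : Ω) :
    ENNReal.ofReal (f (n + 1) w / ((n + 1 : ℕ) : ℝ)) ≤
      ENNReal.ofReal (f 1 w / ((n + 1 : ℕ) : ℝ)) + ENNReal.ofReal (f n (T w) / (n : ℝ)) := by
  have h := hsub 1 n w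
  rw [add_comm 1 n] at h
  simp only [Function.iterate_one] at h
  rcases Nat.eq_zero_or_pos n with rfl | hn
  · simp
  rw [← ENNReal.ofReal_add (div_nonneg (hf _ _) (by positivity))
    (div_nonneg (hf _ _) (by positivity))]
  apply ENNReal.ofReal_le_ofReal
  calc f (n + 1) w / ((n + 1 : ℕ) : ℝ) ≤ (f 1 w + f n (T w)) / ((n + 1 : ℕ) : ℝ) := by gcongr
    _ = f 1 w / ((n + 1 : ℕ) : ℝ) + f n (T w) / ((n + 1 : ℕ) : ℝ) := add_div _ _ _
    _ ≤ _ := by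
      gcongr
      · exact hf _ _
      · omega

/-- Subadditivity with a first block of length one: `f 1 w` vanishes after division, and replacing
`n + 1` by `n` in the denominator only increases the other term. With `ae_eq_const_of_le_comp` this
makes the liminf constant. -/
lemma liminf_div_le_comp {f : ℕ → Ω → ℝ} (hf : ∀ n w, 0 ≤ f n w)
    (hsub : ∀ m n w, f (m + n) w ≤ f m w + f n (T^[m] w)) (w : Ω) :
    liminf (fun n : ℕ => ENNReal.ofReal (f n w / n)) atTop ≤
      liminf (fun n : ℕ => ENNReal.ofReal (f n (T w) / n)) atTop := by
  rw [← liminf_nat_add (fun n : ℕ => ENNReal.ofReal (f n w / n)) 1,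
    ← ENNReal.liminf_add_of_left_tendsto_zero (tendsto_ofReal_div_nat_succ (f 1 w))
      (fun n : ℕ => ENNReal.ofReal (f n (T w) / n))]
  exact liminf_le_liminf (Eventually.of_forall fun n => ofReal_div_succ_le hf hsub n w)

lemma limsup_div_le_comp {f : ℕ → Ω → ℝ} (hf : ∀ n w, 0 ≤ f n w)
    (hsub : ∀ m n w, f (m + n) w ≤ f m w + f n (T^[m] w)) (w : Ω) :
    limsup (fun n : ℕ => ENNReal.ofReal (f n w / n)) atTop ≤
      limsup (fun n : ℕ => ENNReal.ofReal (f n (T w) / n)) atTop := by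
  rw [← limsup_nat_add (fun n : ℕ => ENNReal.ofReal (f n w / n)) 1,
    ← ENNReal.limsup_add_of_left_tendsto_zero (tendsto_ofReal_div_nat_succ (f 1 w))
      (fun n : ℕ => ENNReal.ofReal (f n (T w) / n))]
  exact limsup_le_limsup (Eventually.of_forall fun n => ofReal_div_succ_le hf hsub n w)

lemma le_of_forall_nat_mul_le {a c K : ℝ} (h : ∀ n : ℕ, n * a ≤ n * c + K) : a ≤ c := by
  by_contra hlt
  push Not at hlt
  obtain ⟨n, hn⟩ := exists_nat_gt (K / (a - c))
  rw [div_lt_iff₀ (by linarith)] at hn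
  nlinarith [h n]

variable [MeasurableSpace Ω] {P : Measure Ω}


/-- A function which does not decrease along an ergodic transformation is almost surely constant. -/
lemma ae_eq_const_of_le_comp [IsFiniteMeasure P] (hT : Ergodic T P) {g : Ω → ℝ≥0∞}
    (hg : Measurable g) (hle : ∀ w, g w ≤ g (T w)) : ∃ c, g =ᵐ[P] fun _ => c := by
  have : HasCountableSeparatingOn ℝ≥0∞ (· ∈ Set.range Set.Ici) Set.univ :=
    HasCountableSeparatingOn.range_Ici
  refine exists_eventuallyEq_const_of_forall_separating (· ∈ Set.range Set.Ici) ?_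
  rintro _ ⟨a, rfl⟩
  have hm : MeasurableSet (g ⁻¹' Set.Ici a) := hg measurableSet_Ici
  -- An upper level set is contained in its preimage, hence is null or conull, and countably many
  -- upper level sets separate values.
  rcases hT.ae_empty_or_univ_of_ae_le_preimage hm.nullMeasurableSet
    (LE.le.eventuallyLE fun w (hw : a ≤ g w) => hw.trans (hle w)) with h | h
  · right
    filter_upwards [h.mem_iff] with w hw using by simpa using hw
  · left
    filter_upwards [h.mem_iff] with w hw using by simpa using hw

lemma measurable_birkhoffSum (hT : Measurable T) {g : Ω → ℝ} (hg : Measurable g) (n : ℕ) :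
    Measurable (birkhoffSum T g n) := by
  unfold birkhoffSum
  exact Finset.measurable_sum _ fun i _ => hg.comp (hT.iterate i)

lemma integrable_birkhoffSum (hT : MeasurePreserving T P P) {g : Ω → ℝ} (hg : Integrable g P)
    (n : ℕ) : Integrable (birkhoffSum T g n) P := by
  unfold birkhoffSum
  exact integrable_finsetSum _ fun i _ => (hT.iterate i).integrable_comp_of_integrable hg

lemma integral_birkhoffSum (hT : MeasurePreserving T P P) {g : Ω → ℝ} (hm : Measurable g)
    (hg : Integrable g P) (n : ℕ) : ∫ w, birkhoffSum T g n w ∂P = n * ∫ w, g w ∂P := by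
  unfold birkhoffSum
  rw [integral_finsetSum (f := fun i w => g (T^[i] w)) _
    fun i _ => (hT.iterate i).integrable_comp_of_integrable hg]
  have : ∀ i, ∫ w, g (T^[i] w) ∂P = ∫ w, g w ∂P := fun i => by
    have := integral_map (hT.iterate i).measurable.aemeasurable
      (f := g) (by rw [(hT.iterate i).map_eq]; exact hm.aestronglyMeasurable)
    rw [(hT.iterate i).map_eq] at this
    exact this.symm
  simp [this]

/-- A subadditive cocycle which is almost surely nonpositive at some time is bounded by Birkhoff
sums of a function of small integral, up to a boundary term. -/
lemma exists_small_greedy_bound {F : ℕ → Ω → ℝ} {b : Ω → ℝ}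
    (hFm : ∀ n, Measurable (F n)) (hbm : Measurable b) (hbi : Integrable b P)
    (hF0 : ∀ w, F 0 w ≤ 0) (hF1 : ∀ w, F 1 w ≤ b w) (hb : ∀ w, 0 ≤ b w)
    (hF : ∀ m n w, F (m + n) w ≤ F m w + F n (T^[m] w))
    (hA : ∀ᵐ w ∂P, ∃ k, 1 ≤ k ∧ F k w ≤ 0) {δ : ℝ} (hδ : 0 < δ) :
    ∃ (g : Ω → ℝ) (N : ℕ), Measurable g ∧ Integrable g P ∧ (∀ w, 0 ≤ g w) ∧ ∫ w, g w ∂P < δ ∧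
      ∀ n w, F n w ≤ birkhoffSum T g n w
        + (birkhoffSum T b n w - birkhoffSum T b (n - N) w) := by
  -- The points without a good time up to `N` decrease to a null set as `N` grows, so the integral
  -- of `b` over them becomes smaller than `δ`.
  let A : ℕ → Set Ω := fun N => {w | ∀ k, 1 ≤ k → k ≤ N → 0 < F k w}
  have hAm : ∀ N, MeasurableSet (A N) := fun N => by
    have : A N = ⋂ k, ⋂ (_ : 1 ≤ k), ⋂ (_ : k ≤ N), {w | 0 < F k w} := by
      ext w; simp [A]
    rw [this]
    exact MeasurableSet.iInter fun k => MeasurableSet.iInter fun _ => MeasurableSet.iInter fun _ =>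
      measurableSet_lt measurable_const (hFm k)
  have hanti : Antitone A := fun M N h w hw k h1 h2 => hw k h1 (h2.trans h)
  have hlim := tendsto_setIntegral_of_antitone (μ := P) (f := b) hAm hanti ⟨0, hbi.integrableOn⟩
  have hz : ∫ w in ⋂ n, A n, b w ∂P = 0 := by
    have : P (⋂ n, A n) = 0 := by
      refine measure_mono_null ?_ hA
      intro w hw
      simp only [Set.mem_iInter] at hw
      rintro ⟨k, h1, h2⟩
      exact absurd (hw k k h1 le_rfl) (not_lt.2 h2)
    exact setIntegral_measure_zero _ this
  rw [hz] at hlim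
  obtain ⟨N, hN⟩ := (hlim.eventually_lt_const hδ).exists
  refine ⟨(A N).indicator b, N, hbm.indicator (hAm N), hbi.indicator (hAm N),
    fun w => Set.indicator_nonneg (fun _ _ => hb _) _, ?_, ?_⟩
  · rwa [integral_indicator (hAm N)]
  · refine subadditive_le_of_greedy hF0 hF1 hb hF ?_
    intro w hw
    simp only [A, Set.mem_ofPred_eq, not_forall, not_lt] at hw
    obtain ⟨k, h1, h2, h3⟩ := hw
    exact ⟨k, h1, h2, h3⟩

/-- The boundary term is a sum of at most `N` translates of `b`, each with the integral of `b`. This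
is independent of `n` and disappears after division by `n`. -/
lemma integral_greedy_bound (hT : MeasurePreserving T P P) {g b : Ω → ℝ} (hgm : Measurable g)
    (hgi : Integrable g P) (hbm : Measurable b) (hbi : Integrable b P) (hb : ∀ w, 0 ≤ b w)
    (n N : ℕ) :
    ∫ w, (birkhoffSum T g n w + (birkhoffSum T b n w - birkhoffSum T b (n - N) w)) ∂P
      ≤ n * ∫ w, g w ∂P + N * ∫ w, b w ∂P := by
  have hi := (integrable_birkhoffSum hT hbi n).sub (integrable_birkhoffSum hT hbi (n - N))
  simp only [Pi.sub_def] at hi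
  rw [integral_add (integrable_birkhoffSum hT hgi n) hi, integral_sub (integrable_birkhoffSum hT hbi n) (integrable_birkhoffSum hT hbi _),
    integral_birkhoffSum hT hgm hgi, integral_birkhoffSum hT hbm hbi,
    integral_birkhoffSum hT hbm hbi, ← sub_mul]
  have h1 : (n : ℝ) - (n - N : ℕ) ≤ N := by
    have : n ≤ (n - N) + N := by omega
    have : (n : ℝ) ≤ (n - N : ℕ) + N := by exact_mod_cast this
    linarith
  have h2 : 0 ≤ ∫ w, b w ∂P := integral_nonneg hb
  gcongr

/-- The upper half of the ergodic theorem for nonnegative functions. -/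
lemma eventually_birkhoffSum_le [IsProbabilityMeasure P] (hT : Ergodic T P) {g : Ω → ℝ}
    (hgm : Measurable g) (hgi : Integrable g P) (hg : ∀ w, 0 ≤ g w) {c : ℝ}
    (hc : ∫ w, g w ∂P < c) : ∀ᵐ w ∂P, ∀ᶠ n : ℕ in atTop, birkhoffSum T g n w ≤ c * n := by
  have hTp := hT.toMeasurePreserving
  have hS : ∀ n w, 0 ≤ birkhoffSum T g n w := fun n w => Finset.sum_nonneg fun i _ => hg _
  have hmeas : Measurable fun w =>
      limsup (fun n : ℕ => ENNReal.ofReal (birkhoffSum T g n w / n)) atTop :=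
    Measurable.limsup fun n =>
      ((measurable_birkhoffSum hTp.measurable hgm n).div_const _).ennreal_ofReal
  obtain ⟨m, hm⟩ := ae_eq_const_of_le_comp hT hmeas
    (limsup_div_le_comp hS fun m n w => (birkhoffSum_add T g m n w).le)
  have hmle : m ≤ ENNReal.ofReal (∫ w, g w ∂P) := by
    by_contra hlt
    push Not at hlt
    obtain ⟨q, hq1, hq2⟩ := ENNReal.lt_iff_exists_nnreal_btwn.1 hlt
    have hq : ∫ w, g w ∂P < q := by
      have h := (ENNReal.ofReal_lt_iff_lt_toReal (integral_nonneg hg) ENNReal.coe_ne_top).1 hq1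
      simpa using h
    have key : ∀ δ : ℝ, 0 < δ → (q : ℝ) - ∫ w, g w ∂P ≤ δ := by
      intro δ hδ
      -- If the limsup exceeds `q`, then `k * q - birkhoffSum T g k` is nonpositive for some `k ≥
      -- 1`. Integrating the greedy bound gives `n * (q - ∫ g) ≤ n * δ + N * q`.
      obtain ⟨a, N, ham, hai, -, haδ, ha⟩ := exists_small_greedy_bound (T := T) (P := P)
        (F := fun k w => k * (q : ℝ) - birkhoffSum T g k w) (b := fun _ => (q : ℝ))
        (fun n => measurable_const.sub (measurable_birkhoffSum hTp.measurable hgm n))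
        measurable_const (integrable_const _) (by simp) (by simpa using hg)
        (fun _ => q.2) (by
          intro m n w
          rw [birkhoffSum_add]
          push_cast
          linarith) (by
          filter_upwards [hm] with w hw
          rw [← hw] at hq2
          obtain ⟨n, hn1, hn2⟩ :=
            ((frequently_lt_of_lt_limsup (by isBoundedDefault) hq2).and_eventually
              (eventually_ge_atTop 1)).exists
          refine ⟨n, hn2, ?_⟩
          have hn' : (0 : ℝ) < n := by exact_mod_cast hn2
          have := (ENNReal.lt_ofReal_iff_toReal_lt ENNReal.coe_ne_top).1 hn1
          rw [ENNReal.coe_toReal, lt_div_iff₀ hn'] at this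
          linarith) hδ
      apply le_of_forall_nat_mul_le (K := N * q)
      intro n
      have h1 := integral_mono
        ((integrable_const _).sub (integrable_birkhoffSum hTp hgi n))
        ((integrable_birkhoffSum hTp hai n).add
          ((integrable_birkhoffSum hTp (integrable_const (q : ℝ)) n).sub
            (integrable_birkhoffSum hTp (integrable_const (q : ℝ)) (n - N)))) (ha n)
      have h2 := integral_greedy_bound hTp ham hai measurable_const
        (integrable_const (q : ℝ)) (fun _ => q.2) n N
      have h3 : ∫ w, ((n : ℝ) * q - birkhoffSum T g n w) ∂P = n * (q - ∫ w, g w ∂P) := by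
        rw [integral_sub (integrable_const _) (integrable_birkhoffSum hTp hgi n),
          integral_birkhoffSum hTp hgm hgi]
        simp [mul_sub]
      have h4 : (n : ℝ) * ∫ w, a w ∂P ≤ n * δ := by gcongr
      have h5 : ∫ _w : Ω, (q : ℝ) ∂P = q := by simp
      rw [h5] at h2
      have h6 := h1.trans h2
      simp only [Pi.sub_apply] at h6
      rw [h3] at h6
      linarith
    have := le_of_forall_pos_le_add (a := (q : ℝ) - ∫ w, g w ∂P) (b := 0)
      (by simpa using key)
    linarith
  have hcpos : 0 < c := (integral_nonneg hg).trans_lt hc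
  filter_upwards [hm] with w hw
  have hlt : limsup (fun n : ℕ => ENNReal.ofReal (birkhoffSum T g n w / n)) atTop
      < ENNReal.ofReal c := by
    rw [hw]
    exact hmle.trans_lt ((ENNReal.ofReal_lt_ofReal_iff hcpos).2 hc)
  filter_upwards [eventually_lt_of_limsup_lt hlt, eventually_ge_atTop 1] with n hn hn1
  have hn' : (0 : ℝ) < n := by exact_mod_cast hn1
  have := (ENNReal.ofReal_lt_ofReal_iff hcpos).1 hn
  rw [div_lt_iff₀ hn'] at this
  exact this.le

/-- **Kingman's subadditive ergodic theorem** for nonnegative cocycles over an ergodic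
transformation: almost sure and `L¹` convergence to a constant. -/
theorem exists_tendsto_subadditive [IsProbabilityMeasure P] (hT : Ergodic T P)
    {f : ℕ → Ω → ℝ} (hfm : ∀ n, Measurable (f n)) (hf : ∀ n w, 0 ≤ f n w)
    (hf0 : ∀ w, f 0 w = 0) (hf1 : Integrable (f 1) P)
    (hsub : ∀ m n w, f (m + n) w ≤ f m w + f n (T^[m] w)) :
    ∃ c : ℝ, 0 ≤ c ∧ (∀ᵐ w ∂P, Tendsto (fun n : ℕ => f n w / n) atTop (𝓝 c)) ∧
      Tendsto (fun n : ℕ => ∫⁻ w, ENNReal.ofReal |f n w / n - c| ∂P) atTop (𝓝 0) := by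
  have hTp := hT.toMeasurePreserving
  have hle : ∀ n w, f n w ≤ birkhoffSum T (f 1) n w := by
    intro n
    induction n with
    | zero => intro w; simp [hf0]
    | succ n ih =>
      intro w
      rw [add_comm n 1, birkhoffSum_add]
      have h1 := hsub 1 n w
      have h2 := ih (T^[1] w)
      simp only [birkhoffSum_one]
      linarith
  have hfi : ∀ n, Integrable (f n) P := fun n =>
    (integrable_birkhoffSum hTp hf1 n).mono' (hfm n).aestronglyMeasurable
      (Eventually.of_forall fun w => by rw [Real.norm_of_nonneg (hf n w)]; exact hle n w)
  have hmeas : Measurable fun w => liminf (fun n : ℕ => ENNReal.ofReal (f n w / n)) atTop :=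
    Measurable.liminf fun n => ((hfm n).div_const _).ennreal_ofReal
  obtain ⟨m, hm⟩ := ae_eq_const_of_le_comp hT hmeas (liminf_div_le_comp hf hsub)
  have hmtop : m ≠ ⊤ := by
    rintro rfl
    obtain ⟨w, hw1, hw2⟩ := (hm.and
      (eventually_birkhoffSum_le hT (hfm 1) hf1 (hf 1) (lt_add_one _))).exists
    have : liminf (fun n : ℕ => ENNReal.ofReal (f n w / n)) atTop
        ≤ ENNReal.ofReal ((∫ w, f 1 w ∂P) + 1) := by
      refine liminf_le_of_frequently_le' (Eventually.frequently ?_)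
      filter_upwards [hw2, eventually_ge_atTop 1] with n hn hn1
      apply ENNReal.ofReal_le_ofReal
      rw [div_le_iff₀ (by exact_mod_cast hn1)]
      exact (hle n w).trans hn
    beta_reduce at hw1
    rw [hw1] at this
    exact ENNReal.ofReal_ne_top (top_le_iff.1 this)
  set c := m.toReal with hc
  have hc0 : 0 ≤ c := ENNReal.toReal_nonneg
  have hmc : m = ENNReal.ofReal c := (ENNReal.ofReal_toReal hmtop).symm
  have hlow : ∀ᵐ w ∂P, ∀ ε > 0, ∀ᶠ n : ℕ in atTop, c - ε < f n w / n := by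
    filter_upwards [hm] with w hw ε hε
    rcases lt_or_ge (c - ε) 0 with h | h
    · exact Eventually.of_forall fun n => h.trans_le (div_nonneg (hf _ _) (Nat.cast_nonneg _))
    · have hlt : ENNReal.ofReal (c - ε)
          < liminf (fun n : ℕ => ENNReal.ofReal (f n w / n)) atTop := by
        rw [hw, hmc]
        exact (ENNReal.ofReal_lt_ofReal_iff_of_nonneg h).2 (by linarith)
      filter_upwards [eventually_lt_of_lt_liminf hlt] with n hn
      exact (ENNReal.ofReal_lt_ofReal_iff_of_nonneg h).1 hn
  -- The liminf being `c`, the cocycle `f n - n * (c + ε)` is almost surely nonpositive at some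
  -- positive time.
  have greedy : ∀ ε > 0, ∃ (g : Ω → ℝ) (N : ℕ), Measurable g ∧ Integrable g P ∧
      (∀ w, 0 ≤ g w) ∧ ∫ w, g w ∂P < ε ∧
      ∀ n w, f n w - n * (c + ε) ≤ birkhoffSum T g n w
        + (birkhoffSum T (f 1) n w - birkhoffSum T (f 1) (n - N) w) := by
    intro ε hε
    refine exists_small_greedy_bound (F := fun n w => f n w - n * (c + ε))
      (fun n => (hfm n).sub measurable_const) (hfm 1) hf1 (by simp [hf0]) ?_ (hf 1) ?_ ?_ hε
    · intro w
      simp only [Nat.cast_one, one_mul]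
      linarith
    · intro m n w
      have := hsub m n w
      push_cast
      linarith
    · filter_upwards [hm] with w hw
      have hlt : liminf (fun n : ℕ => ENNReal.ofReal (f n w / n)) atTop
          < ENNReal.ofReal (c + ε) := by
        rw [hw, hmc]
        exact (ENNReal.ofReal_lt_ofReal_iff (by linarith)).2 (by linarith)
      obtain ⟨n, hn1, hn2⟩ := ((frequently_lt_of_liminf_lt (by isBoundedDefault)
        hlt).and_eventually (eventually_ge_atTop 1)).exists
      refine ⟨n, hn2, ?_⟩
      have := (ENNReal.ofReal_lt_ofReal_iff (by linarith)).1 hn1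
      rw [div_lt_iff₀ (by exact_mod_cast hn2)] at this
      linarith
  have hup : ∀ ε > 0, ∀ᵐ w ∂P, ∀ᶠ n : ℕ in atTop, f n w / n < c + ε := by
    intro ε' hε'
    -- Four errors of size `ε`: the level `c + ε`, the sum of `g`, the constant `N * K`, and the sum
    -- of the tail `b`.
    obtain ⟨ε, hε, hεε⟩ : ∃ ε : ℝ, 0 < ε ∧ 5 * ε < ε' := ⟨ε' / 6, by linarith, by linarith⟩
    obtain ⟨g, N, hgm, hgi, hg, hgε, hgN⟩ := greedy ε hε
    -- The boundary term involves `f 1` near time `n`, where `f 1` need not be bounded. Cutting at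
    -- height `K` leaves `N * K` plus a Birkhoff sum of small mean.
    have htr : Tendsto (fun K : ℕ => ∫ w, max (f 1 w - K) 0 ∂P) atTop (𝓝 0) := by
      have : Tendsto (fun K : ℕ => ∫ w, max (f 1 w - K) 0 ∂P) atTop (𝓝 (∫ _w, (0 : ℝ) ∂P)) := by
        refine tendsto_integral_of_dominated_convergence (f 1)
          (fun K => (((hfm 1).sub_const _).max measurable_const).aestronglyMeasurable) hf1
          (fun K => Eventually.of_forall fun w => ?_) (Eventually.of_forall fun w => ?_)
        · rw [Real.norm_of_nonneg (le_max_right _ _)]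
          have : (0 : ℝ) ≤ K := Nat.cast_nonneg _
          exact max_le (by linarith) (hf 1 w)
        · obtain ⟨K, hK⟩ := exists_nat_ge (f 1 w)
          refine tendsto_const_nhds.congr' ?_
          filter_upwards [eventually_ge_atTop K] with k hk
          have : (K : ℝ) ≤ k := by exact_mod_cast hk
          rw [max_eq_right (by linarith)]
      simpa using this
    obtain ⟨K, hK⟩ := (htr.eventually_lt_const hε).exists
    set b := fun w => max (f 1 w - K) 0 with hb
    have hbm : Measurable b := ((hfm 1).sub_const _).max measurable_const
    have hbi : Integrable b P := (hf1.sub (integrable_const _)).pos_part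
    have hb0 : ∀ w, 0 ≤ b w := fun w => le_max_right _ _
    have htail : ∀ n w, birkhoffSum T (f 1) n w - birkhoffSum T (f 1) (n - N) w
        ≤ N * K + birkhoffSum T b n w := by
      intro n w
      unfold birkhoffSum
      have h1 : ∑ i ∈ Finset.range n, f 1 (T^[i] w) - ∑ i ∈ Finset.range (n - N), f 1 (T^[i] w)
          = ∑ i ∈ Finset.Ico (n - N) n, f 1 (T^[i] w) :=
        (Finset.sum_Ico_eq_sub _ (Nat.sub_le _ _)).symm
      rw [h1]
      calc ∑ i ∈ Finset.Ico (n - N) n, f 1 (T^[i] w)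
          ≤ ∑ i ∈ Finset.Ico (n - N) n, ((K : ℝ) + b (T^[i] w)) :=
            Finset.sum_le_sum fun i _ => by
              have := le_max_left (f 1 (T^[i] w) - K) 0
              simp only [hb]; linarith
        _ = (n - (n - N) : ℕ) * (K : ℝ) + ∑ i ∈ Finset.Ico (n - N) n, b (T^[i] w) := by
            rw [Finset.sum_add_distrib]; simp
        _ ≤ N * K + ∑ i ∈ Finset.range n, b (T^[i] w) := by
            gcongr
            · omega
            · rw [Finset.range_eq_Ico]
              exact Finset.Ico_subset_Ico_left (Nat.zero_le _)
    filter_upwards [eventually_birkhoffSum_le hT hgm hgi hg hgε,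
      eventually_birkhoffSum_le hT hbm hbi hb0 hK] with w h1 h2
    obtain ⟨M, hM⟩ := exists_nat_gt (N * K / ε)
    filter_upwards [h1, h2, eventually_ge_atTop (M + 1)] with n e1 e2 hn
    have hn0 : (0 : ℝ) < n := by exact_mod_cast (by omega : 0 < n)
    rw [div_lt_iff₀ hn0]
    have e3 := hgN n w
    have e4 := htail n w
    have e5 : (M : ℝ) ≤ n := by exact_mod_cast (by omega : M ≤ n)
    rw [div_lt_iff₀ hε] at hM
    have e6 : M * ε ≤ n * ε := by gcongr
    nlinarith
  have hae : ∀ᵐ w ∂P, Tendsto (fun n : ℕ => f n w / n) atTop (𝓝 c) := by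
    have hup' : ∀ᵐ w ∂P, ∀ j : ℕ, ∀ᶠ n : ℕ in atTop, f n w / n < c + 1 / ((j : ℝ) + 1) :=
      ae_all_iff.2 fun j => hup _ Nat.one_div_pos_of_nat
    filter_upwards [hlow, hup'] with w h1 h2
    refine tendsto_order.2 ⟨fun a ha => ?_, fun a ha => ?_⟩
    · simpa using h1 (c - a) (by linarith)
    · obtain ⟨j, hj⟩ := exists_nat_one_div_lt (sub_pos.2 ha)
      filter_upwards [h2 j] with n hn
      linarith
  refine ⟨c, hc0, hae, ?_⟩
  have hfni : ∀ n : ℕ, Integrable (fun w => f n w / n) P := fun n => (hfi n).div_const _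
  -- The negative part of the deviation is bounded by `c`, so dominated convergence applies to it;
  -- the positive part is controlled through the mean, bounded in `hint` by the greedy estimate.
  have hneg : Tendsto (fun n : ℕ => ∫ w, max (c - f n w / n) 0 ∂P) atTop (𝓝 0) := by
    have : Tendsto (fun n : ℕ => ∫ w, max (c - f n w / n) 0 ∂P) atTop (𝓝 (∫ _w, (0 : ℝ) ∂P)) := by
      refine tendsto_integral_of_dominated_convergence (fun _ => c)
        (fun n => ((measurable_const.sub ((hfm n).div_const _)).max
          measurable_const).aestronglyMeasurable) (integrable_const _)
        (fun n => Eventually.of_forall fun w => ?_) ?_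
      · rw [Real.norm_of_nonneg (le_max_right _ _)]
        have : 0 ≤ f n w / n := div_nonneg (hf _ _) (Nat.cast_nonneg _)
        exact max_le (by linarith) hc0
      · filter_upwards [hae] with w hw
        simpa using (hw.const_sub c).max (tendsto_const_nhds (x := (0 : ℝ)))
    simpa using this
  have hint : ∀ ε > 0, ∀ᶠ n : ℕ in atTop, ∫ w, f n w / n ∂P ≤ c + ε := by
    intro ε' hε'
    obtain ⟨ε, hε, hεε⟩ : ∃ ε : ℝ, 0 < ε ∧ 3 * ε < ε' := ⟨ε' / 4, by linarith, by linarith⟩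
    obtain ⟨g, N, hgm, hgi, hg, hgε, hgN⟩ := greedy ε hε
    obtain ⟨M, hM⟩ := exists_nat_gt (N * (∫ w, f 1 w ∂P) / ε)
    filter_upwards [eventually_ge_atTop (M + 1)] with n hn
    have hn0 : (0 : ℝ) < n := by exact_mod_cast (by omega : 0 < n)
    have h1 := integral_mono ((hfi n).sub (integrable_const (n * (c + ε))))
      ((integrable_birkhoffSum hTp hgi n).add ((integrable_birkhoffSum hTp hf1 n).sub
        (integrable_birkhoffSum hTp hf1 (n - N)))) (hgN n)
    have h2 := h1.trans (integral_greedy_bound hTp hgm hgi (hfm 1) hf1 (hf 1) n N)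
    have h3 : ∫ w, (f n w - n * (c + ε)) ∂P = ∫ w, f n w ∂P - n * (c + ε) := by
      rw [integral_sub (hfi n) (integrable_const _)]
      simp
    replace h2 := h3.symm.trans_le h2
    rw [integral_div, div_le_iff₀ hn0]
    have e5 : (M : ℝ) ≤ n := by exact_mod_cast (by omega : M ≤ n)
    rw [div_lt_iff₀ hε] at hM
    have e6 : M * ε ≤ n * ε := by gcongr
    have e7 : n * ∫ w, g w ∂P ≤ n * ε := by gcongr
    nlinarith
  have hL1 : Tendsto (fun n : ℕ => ∫ w, |f n w / n - c| ∂P) atTop (𝓝 0) := by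
    -- The identity `|t| = t + 2 * max (-t) 0`, integrated.
    have hid : ∀ n : ℕ, ∫ w, |f n w / n - c| ∂P
        = ∫ w, f n w / n ∂P - c + 2 * ∫ w, max (c - f n w / n) 0 ∂P := by
      intro n
      have hmi : Integrable (fun w => max (c - f n w / n) 0) P :=
        ((integrable_const c).sub (hfni n)).pos_part
      have hi2 : Integrable (fun w => f n w / n - c) P := (hfni n).sub (integrable_const c)
      rw [← integral_const_mul]
      have : ∫ w, f n w / n ∂P - c = ∫ w, (f n w / n - c) ∂P := by
        rw [integral_sub (hfni n) (integrable_const c)]; simp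
      rw [this, ← integral_add hi2 (hmi.const_mul 2)]
      refine integral_congr_ae (Eventually.of_forall fun w => ?_)
      simp only
      rcases le_total c (f n w / n) with h | h
      · rw [abs_of_nonneg (by linarith), max_eq_right (by linarith)]; ring
      · rw [abs_of_nonpos (by linarith), max_eq_left (by linarith)]; ring
    refine tendsto_order.2 ⟨fun a ha => Eventually.of_forall fun n =>
      ha.trans_le (integral_nonneg fun w => abs_nonneg _), fun a ha => ?_⟩
    filter_upwards [hint (a / 4) (by linarith), hneg.eventually_lt_const
      (show 0 < a / 4 by linarith)] with n h1 h2
    rw [hid]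
    linarith
  have := ENNReal.tendsto_ofReal hL1
  rw [ENNReal.ofReal_zero] at this
  refine this.congr fun n => ?_
  exact ofReal_integral_eq_lintegral_ofReal ((hfni n).sub (integrable_const c)).abs
    (Eventually.of_forall fun w => abs_nonneg _)

end ErgodicTheory
end

noncomputable section

/-! ### Transition probabilities, distance, and the transition operator on a finite set of vertices.
-/

namespace RandomGraph

namespace Graph

variable (G : Graph)

/-- The finite set of neighbors of a vertex. -/
def nbrs (x : G.V) : Finset G.V := (G.locFin x).toFinset

lemma mem_nbrs {x y : G.V} : y ∈ G.nbrs x ↔ 0 < G.mult x y := by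
  simp [nbrs]

lemma deg_eq_sum {x : G.V} {F : Finset G.V} (h : G.nbrs x ⊆ F) :
    G.deg x = ∑ y ∈ F, G.mult x y := by
  refine finsum_eq_sum_of_support_subset _ fun y hy => h (G.mem_nbrs.2 ?_)
  exact Nat.pos_of_ne_zero hy

lemma sum_mult_le_deg (x : G.V) (F : Finset G.V) : ∑ y ∈ F, G.mult x y ≤ G.deg x := by
  classical
  rw [G.deg_eq_sum (F := F ∪ G.nbrs x) Finset.subset_union_right]
  exact Finset.sum_le_sum_of_subset Finset.subset_union_left

lemma p_nonneg (x y : G.V) : 0 ≤ G.p x y := by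
  unfold p; positivity

lemma p_eq_zero {x y : G.V} (h : y ∉ G.nbrs x) : G.p x y = 0 := by
  rw [mem_nbrs, Nat.pos_iff_ne_zero, not_not] at h
  simp [p, h]

lemma p_pos {x y : G.V} (h : 0 < G.mult x y) : 0 < G.p x y :=
  div_pos (by exact_mod_cast h) (by exact_mod_cast G.deg_pos x)

lemma sum_p (x : G.V) : ∑ y ∈ G.nbrs x, G.p x y = 1 := by
  have h := G.deg_pos x
  unfold p
  rw [← Finset.sum_div, div_eq_one_iff_eq (by exact_mod_cast h.ne'),
    G.deg_eq_sum (F := G.nbrs x) subset_rfl]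
  push_cast; rfl

lemma pn_zero (x y : G.V) [Decidable (x = y)] : G.pn 0 x y = if x = y then 1 else 0 := by
  rw [pn]; congr

lemma pn_succ (n : ℕ) (x y : G.V) :
    G.pn (n + 1) x y = ∑ z ∈ G.nbrs x, G.p x z * G.pn n z y := by
  rw [pn]
  refine tsum_eq_sum fun z hz => ?_
  rw [G.p_eq_zero hz, zero_mul]

lemma pn_nonneg (n : ℕ) (x y : G.V) : 0 ≤ G.pn n x y := by
  induction n generalizing x with
  | zero => classical rw [pn_zero]; split_ifs <;> norm_num
  | succ n ih =>
    rw [pn_succ]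
    exact Finset.sum_nonneg fun z _ => mul_nonneg (G.p_nonneg _ _) (ih z)

lemma pn_le_one (n : ℕ) (x y : G.V) : G.pn n x y ≤ 1 := by
  induction n generalizing x with
  | zero => classical rw [pn_zero]; split_ifs <;> norm_num
  | succ n ih =>
    rw [pn_succ, ← G.sum_p x]
    exact Finset.sum_le_sum fun z _ => mul_le_of_le_one_right (G.p_nonneg _ _) (ih z)

lemma pn_one (x y : G.V) : G.pn 1 x y = G.p x y := by
  classical
  rw [pn_succ]
  simp only [pn_zero, mul_ite, mul_one, mul_zero, Finset.sum_ite_eq']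
  split_ifs with h
  · rfl
  · rw [G.p_eq_zero h]

/-- One half of the Chapman-Kolmogorov equation. -/
lemma pn_mul_pn_le (m n : ℕ) (x y z : G.V) :
    G.pn m x y * G.pn n y z ≤ G.pn (m + n) x z := by
  classical
  induction m generalizing x with
  | zero =>
    rw [pn_zero, zero_add]
    split_ifs with h
    · rw [h, one_mul]
    · rw [zero_mul]; exact G.pn_nonneg _ _ _
  | succ m ih =>
    rw [Nat.add_right_comm, pn_succ, pn_succ, Finset.sum_mul]
    refine Finset.sum_le_sum fun w _ => ?_
    rw [mul_assoc]
    exact mul_le_mul_of_nonneg_left (ih w) (G.p_nonneg _ _)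

lemma pn_pos_of_path {ω : ℕ → G.V} (h : ∀ n, 0 < G.mult (ω n) (ω (n + 1))) (m n : ℕ) :
    0 < G.pn n (ω m) (ω (m + n)) := by
  induction n with
  | zero => classical simp [pn_zero]
  | succ n ih =>
    refine (mul_pos ih ?_).trans_le (G.pn_mul_pn_le n 1 _ (ω (m + n)) _)
    rw [pn_one]
    exact G.p_pos (h _)

/-! Elementary properties of the distance. -/

lemma dist_self (x : G.V) : G.dist x x = 0 := SimpleGraph.dist_self

lemma dist_comm (x y : G.V) : G.dist x y = G.dist y x := SimpleGraph.dist_comm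

lemma dist_triangle (x y z : G.V) : G.dist x z ≤ G.dist x y + G.dist y z := by
  have : Nonempty G.V := ⟨x⟩
  exact SimpleGraph.Connected.dist_triangle ⟨G.reachable⟩

lemma dist_le_one {x y : G.V} (h : 0 < G.mult x y) : G.dist x y ≤ 1 := by
  by_cases hxy : x = y
  · rw [hxy, dist_self]; exact zero_le_one
  · have hadj : G.simple.Adj x y := ⟨hxy, h⟩
    exact SimpleGraph.dist_le hadj.toWalk

lemma eq_of_dist_eq_zero {x y : G.V} (h : G.dist x y = 0) : x = y :=
  (G.reachable x y).dist_eq_zero_iff.1 h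

lemma exists_mult_pos_dist_le {x y : G.V} {n : ℕ} (h : G.dist x y ≤ n + 1) (hne : x ≠ y) :
    ∃ z, 0 < G.mult x z ∧ G.dist z y ≤ n := by
  obtain ⟨w, hw⟩ := (G.reachable x y).exists_walk_length_eq_dist
  cases w with
  | nil => exact absurd rfl hne
  | @cons _ z _ hz w =>
    refine ⟨z, hz.2, (SimpleGraph.dist_le w).trans ?_⟩
    rw [SimpleGraph.Walk.length_cons] at hw
    change _ = G.dist x y at hw
    omega

lemma ball_finite (x : G.V) (r : ℕ) : (G.ball x r).Finite := by
  induction r generalizing x with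
  | zero =>
    refine (Set.finite_singleton x).subset fun y hy => ?_
    exact (G.eq_of_dist_eq_zero (Nat.le_zero.1 hy)).symm
  | succ r ih =>
    refine ((Set.finite_singleton x).union
      ((G.nbrs x).finite_toSet.biUnion fun z _ => ih z)).subset fun y hy => ?_
    by_cases hxy : x = y
    · exact Or.inl hxy.symm
    · obtain ⟨z, h1, h2⟩ := G.exists_mult_pos_dist_le hy hxy
      exact Or.inr (Set.mem_biUnion (G.mem_nbrs.2 h1) h2)

lemma mem_ball_self (x : G.V) (r : ℕ) : x ∈ G.ball x r := by
  change G.dist x x ≤ r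
  rw [dist_self]; exact Nat.zero_le _

lemma ball_subset_ball {x z : G.V} {r : ℕ} (h : 0 < G.mult x z) :
    G.ball z r ⊆ G.ball x (r + 1) := fun y (hy : G.dist z y ≤ r) => by
  have := G.dist_triangle x z y
  have := G.dist_le_one h
  change G.dist x y ≤ r + 1
  omega

/-! The Varopoulos-Carne bound. -/

section VaropoulosCarne

/-- The transition operator restricted to a finite set of vertices. -/
def truncOp (F : Finset G.V) : (G.V → ℝ) →ₗ[ℝ] (G.V → ℝ) where
  toFun f a := ∑ b ∈ F, G.p a b * f b
  map_add' f g := by ext a; simp [mul_add, Finset.sum_add_distrib]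
  map_smul' c f := by ext a; simp [Finset.mul_sum, mul_left_comm]

lemma truncOp_apply (F : Finset G.V) (f : G.V → ℝ) (a : G.V) :
    G.truncOp F f a = ∑ b ∈ F, G.p a b * f b := rfl

/-- The scalar product with respect to the degree, on a finite set of vertices. -/
def degForm (F : Finset G.V) : (G.V → ℝ) →ₗ[ℝ] (G.V → ℝ) →ₗ[ℝ] ℝ :=
  LinearMap.mk₂ ℝ (fun f g => ∑ a ∈ F, (G.deg a : ℝ) * (f a * g a))
    (fun f f' g => by simp [add_mul, mul_add, Finset.sum_add_distrib])
    (fun c f g => by simp [Finset.mul_sum, mul_left_comm, mul_assoc])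
    (fun f g g' => by simp [mul_add, Finset.sum_add_distrib])
    (fun c f g => by simp [Finset.mul_sum, mul_left_comm])

lemma degForm_apply (F : Finset G.V) (f g : G.V → ℝ) :
    G.degForm F f g = ∑ a ∈ F, (G.deg a : ℝ) * (f a * g a) := rfl

lemma degForm_comm (F : Finset G.V) (f g : G.V → ℝ) :
    G.degForm F f g = G.degForm F g f := by
  simp only [degForm_apply, mul_comm (f _)]

lemma deg_mul_p (a b : G.V) : (G.deg a : ℝ) * G.p a b = G.mult a b := by
  have : (G.deg a : ℝ) ≠ 0 := by exact_mod_cast (G.deg_pos a).ne'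
  unfold p
  field_simp

/-- Reversibility: `deg a * p a b = mult a b` is symmetric in `a` and `b`. -/
lemma degForm_truncOp (F : Finset G.V) (f g : G.V → ℝ) :
    G.degForm F (G.truncOp F f) g = G.degForm F f (G.truncOp F g) := by
  have h1 : G.degForm F (G.truncOp F f) g
      = ∑ a ∈ F, ∑ b ∈ F, (G.mult a b : ℝ) * (f b * g a) := by
    rw [degForm_apply]
    refine Finset.sum_congr rfl fun a _ => ?_
    rw [truncOp_apply, Finset.sum_mul, Finset.mul_sum]
    refine Finset.sum_congr rfl fun b _ => ?_
    rw [← G.deg_mul_p]; ring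
  have h2 : G.degForm F f (G.truncOp F g)
      = ∑ a ∈ F, ∑ b ∈ F, (G.mult a b : ℝ) * (f a * g b) := by
    rw [degForm_apply]
    refine Finset.sum_congr rfl fun a _ => ?_
    rw [truncOp_apply, Finset.mul_sum, Finset.mul_sum]
    refine Finset.sum_congr rfl fun b _ => ?_
    rw [← G.deg_mul_p]; ring
  rw [h1, h2, Finset.sum_comm]
  refine Finset.sum_congr rfl fun a _ => Finset.sum_congr rfl fun b _ => ?_
  rw [G.symm]

/-- Cauchy-Schwarz at each vertex `a` with weights `mult a b`, of total mass at most `deg a`;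
summing over `a` then uses the symmetry of `mult` and the same bound on the mass. -/
lemma degForm_truncOp_self_le (F : Finset G.V) (f : G.V → ℝ) :
    G.degForm F (G.truncOp F f) (G.truncOp F f) ≤ G.degForm F f f := by
  have h1 : ∀ a, (G.deg a : ℝ) * (G.truncOp F f a * G.truncOp F f a)
      ≤ ∑ b ∈ F, (G.mult a b : ℝ) * (f b * f b) := by
    intro a
    have hd : (0 : ℝ) < G.deg a := by exact_mod_cast G.deg_pos a
    have hcs := Finset.sum_mul_sq_le_sq_mul_sq F (fun b => √(G.mult a b : ℝ))
      (fun b => √(G.mult a b : ℝ) * f b)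
    have e1 : ∑ b ∈ F, √(G.mult a b : ℝ) * (√(G.mult a b : ℝ) * f b)
        = G.deg a * G.truncOp F f a := by
      rw [truncOp_apply, Finset.mul_sum]
      refine Finset.sum_congr rfl fun b _ => ?_
      rw [← mul_assoc, ← mul_assoc, Real.mul_self_sqrt (Nat.cast_nonneg _), G.deg_mul_p]
    have e2 : ∑ b ∈ F, √(G.mult a b : ℝ) ^ 2 ≤ G.deg a := by
      simp only [Real.sq_sqrt (Nat.cast_nonneg _)]
      exact_mod_cast G.sum_mult_le_deg a F
    have e3 : ∑ b ∈ F, (√(G.mult a b : ℝ) * f b) ^ 2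
        = ∑ b ∈ F, (G.mult a b : ℝ) * (f b * f b) := by
      refine Finset.sum_congr rfl fun b _ => ?_
      rw [mul_pow, Real.sq_sqrt (Nat.cast_nonneg _), sq]
    rw [e1, e3] at hcs
    have h0 : 0 ≤ ∑ b ∈ F, (G.mult a b : ℝ) * (f b * f b) :=
      Finset.sum_nonneg fun b _ => mul_nonneg (Nat.cast_nonneg _) (mul_self_nonneg _)
    have h2 := hcs.trans (mul_le_mul_of_nonneg_right e2 h0)
    refine le_of_mul_le_mul_left ?_ hd
    linarith [h2]
  calc G.degForm F (G.truncOp F f) (G.truncOp F f)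
      ≤ ∑ a ∈ F, ∑ b ∈ F, (G.mult a b : ℝ) * (f b * f b) := Finset.sum_le_sum fun a _ => h1 a
    _ = ∑ b ∈ F, (∑ a ∈ F, (G.mult b a : ℝ)) * (f b * f b) := by
      rw [Finset.sum_comm]
      refine Finset.sum_congr rfl fun b _ => ?_
      rw [Finset.sum_mul]
      refine Finset.sum_congr rfl fun a _ => ?_
      rw [G.symm]
    _ ≤ _ := by
      refine Finset.sum_le_sum fun b _ => mul_le_mul_of_nonneg_right ?_ (mul_self_nonneg _)
      exact_mod_cast G.sum_mult_le_deg b F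

end VaropoulosCarne

end Graph

/-! ### Chebyshev polynomials of a self-adjoint contraction. -/

/-- The pair `(T_k(Q) f, U_{k-1}(Q) f)` of Chebyshev polynomials of an operator `Q`. -/
def chebyshevPair {E : Type*} [AddCommGroup E] [Module ℝ E] (Q : E →ₗ[ℝ] E) (f : E) : ℕ → E × E
  | 0 => (f, 0)
  | k + 1 => (Q (chebyshevPair Q f k).1 - (chebyshevPair Q f k).2 + Q (Q (chebyshevPair Q f k).2),
      Q (chebyshevPair Q f k).2 + (chebyshevPair Q f k).1)

section Chebyshev

variable {E : Type*} [AddCommGroup E] [Module ℝ E] {Q : E →ₗ[ℝ] E} (f : E)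

/-- The Pell identity T_k² + (1 - x²) U_{k-1}² = 1, read through the quadratic form. It bounds
T_k(Q) without any spectral theory. -/
lemma chebyshevPair_energy {B : E →ₗ[ℝ] E →ₗ[ℝ] ℝ} (hB : ∀ a b, B a b = B b a)
    (hQ : ∀ a b, B (Q a) b = B a (Q b)) (k : ℕ) :
    B (chebyshevPair Q f k).1 (chebyshevPair Q f k).1
      + B (chebyshevPair Q f k).2 (chebyshevPair Q f k).2
      - B (Q (chebyshevPair Q f k).2) (Q (chebyshevPair Q f k).2) = B f f := by
  induction k with
  | zero => simp [chebyshevPair]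
  | succ k ih =>
    rw [← ih, chebyshevPair]
    generalize (chebyshevPair Q f k).1 = u
    generalize (chebyshevPair Q f k).2 = s
    simp only [map_add, map_sub, LinearMap.add_apply, LinearMap.sub_apply, hQ]
    have h2 : B s (Q u) = B u (Q s) := by rw [hB, hQ]
    have h4 : B s (Q (Q (Q u))) = B u (Q (Q (Q s))) := by rw [hB, hQ, hQ, hQ]
    rw [h2, h4]
    ring

lemma chebyshevPair_fst_le {B : E →ₗ[ℝ] E →ₗ[ℝ] ℝ} (hB : ∀ a b, B a b = B b a)
    (hQ : ∀ a b, B (Q a) b = B a (Q b)) (hle : ∀ a, B (Q a) (Q a) ≤ B a a) (k : ℕ) :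
    B (chebyshevPair Q f k).1 (chebyshevPair Q f k).1 ≤ B f f := by
  linarith [chebyshevPair_energy f hB hQ k, hle (chebyshevPair Q f k).2]

lemma two_smul_apply_chebyshevPair_fst (k : ℕ) :
    (2 : ℝ) • Q (chebyshevPair Q f (k + 1)).1
      = (chebyshevPair Q f (k + 2)).1 + (chebyshevPair Q f k).1 := by
  simp only [chebyshevPair, map_add, map_sub, two_smul]
  abel

/-- If `|φ (T_k(Q) f)|` vanishes for `k < d` and is bounded by `M`, then `|φ (Q ^ n f)|` has
Gaussian tails. -/
lemma abs_apply_iterate_le (φ : E →ₗ[ℝ] ℝ) {M : ℝ} {d : ℕ}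
    (hM : ∀ k, |φ (chebyshevPair Q f k).1| ≤ M)
    (hd : ∀ k < d, φ (chebyshevPair Q f k).1 = 0) (n : ℕ) :
    |φ ((Q ^ n) f)| ≤ 2 * M * Real.exp (-(d : ℝ) ^ 2 / (2 * n)) := by
  have hM0 : 0 ≤ M := (abs_nonneg _).trans (hM 0)
  -- Since 2xT_k = T_{k+1} + T_{k-1}, each power of `Q` averages over the two neighbors of `k`, and
  -- `cosh (s * k)` is an eigenfunction of this averaging with eigenvalue `cosh s`. The factor `exp
  -- (-(s * d))` is affordable at `n = 0` because nothing has to be bounded for `k < d`.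
  have key : ∀ s : ℝ, 0 ≤ s → ∀ n k : ℕ, |φ ((Q ^ n) (chebyshevPair Q f k).1)| ≤
      M * Real.exp (-(s * d)) * Real.cosh s ^ n * (2 * Real.cosh (s * k)) := by
    intro s hs n
    induction n with
    | zero =>
      intro k
      simp only [pow_zero, Module.End.one_apply, mul_one]
      rcases lt_or_ge k d with h | h
      · rw [hd k h, abs_zero]
        have := Real.cosh_pos (s * k)
        positivity
      · refine (hM k).trans ?_
        rw [mul_assoc]
        refine le_mul_of_one_le_right hM0 ?_
        have h1 : s * d ≤ s * k := by gcongr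
        rw [Real.cosh_eq, mul_div_cancel₀ _ two_ne_zero, mul_add, ← Real.exp_add, ← Real.exp_add]
        have h2 : (1 : ℝ) ≤ Real.exp (-(s * d) + s * k) := Real.one_le_exp (by linarith)
        linarith [Real.exp_pos (-(s * d) + -(s * k))]
    | succ n ih =>
      intro k
      have hc := Real.cosh_pos s
      rcases k with _ | k
      · have h0 : (Q ^ (n + 1)) (chebyshevPair Q f 0).1 = (Q ^ n) (chebyshevPair Q f 1).1 := by
          rw [pow_succ, Module.End.mul_apply]
          simp [chebyshevPair]
        rw [h0]
        refine (ih 1).trans (le_of_eq ?_)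
        simp
        ring
      · have h0 : φ ((Q ^ (n + 1)) (chebyshevPair Q f (k + 1)).1)
            = (φ ((Q ^ n) (chebyshevPair Q f (k + 2)).1)
              + φ ((Q ^ n) (chebyshevPair Q f k).1)) / 2 := by
          rw [pow_succ, Module.End.mul_apply, ← map_add, ← map_add,
            ← two_smul_apply_chebyshevPair_fst, map_smul, map_smul, smul_eq_mul]
          ring
        rw [h0, abs_div, abs_two]
        have h1 := ih (k + 2)
        have h2 := ih k
        have h3 := abs_add_le (φ ((Q ^ n) (chebyshevPair Q f (k + 2)).1))
          (φ ((Q ^ n) (chebyshevPair Q f k).1))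
        have e1 : s * ((k + 2 : ℕ) : ℝ) = s * ((k + 1 : ℕ) : ℝ) + s := by push_cast; ring
        have e2 : s * (k : ℝ) = s * ((k + 1 : ℕ) : ℝ) - s := by push_cast; ring
        rw [e1, Real.cosh_add] at h1
        rw [e2, Real.cosh_sub] at h2
        rw [pow_succ]
        rw [div_le_iff₀ two_pos]
        refine (h3.trans (add_le_add h1 h2)).trans (le_of_eq ?_)
        ring
  -- For `n = 0` the quotient in the exponent is 0 by convention, and `s = 0` gives the bound `2 *
  -- M`.
  rcases Nat.eq_zero_or_pos n with rfl | hn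
  · have := key 0 le_rfl 0 0
    simp [chebyshevPair] at this ⊢
    linarith
  have hn' : (0 : ℝ) < n := by exact_mod_cast hn
  -- The choice `s = d / n` minimizes `-s * d + n * s ^ 2 / 2`, obtained from `cosh s ≤ exp (s ^ 2 /
  -- 2)`.
  have h := key (d / n) (by positivity) n 0
  simp only [CharP.cast_eq_zero, mul_zero, Real.cosh_zero, mul_one] at h
  refine h.trans ?_
  have hcosh : Real.cosh ((d : ℝ) / n) ^ n ≤ Real.exp ((d : ℝ) ^ 2 / (2 * n)) := by
    calc Real.cosh ((d : ℝ) / n) ^ n ≤ Real.exp (((d : ℝ) / n) ^ 2 / 2) ^ n := by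
          gcongr
          exact Real.cosh_le_exp_half_sq _
      _ = _ := by
          rw [← Real.exp_nat_mul]
          congr 1
          field_simp
  have e : Real.exp (-((d : ℝ) / n * d)) * Real.exp ((d : ℝ) ^ 2 / (2 * n))
      = Real.exp (-(d : ℝ) ^ 2 / (2 * n)) := by
    rw [← Real.exp_add]
    congr 1
    field_simp
    ring
  rw [← e]
  have hp := Real.exp_pos (-((d : ℝ) / n * d))
  calc M * Real.exp (-((d : ℝ) / n * d)) * Real.cosh ((d : ℝ) / n) ^ n * 2
      ≤ M * Real.exp (-((d : ℝ) / n * d)) * Real.exp ((d : ℝ) ^ 2 / (2 * n)) * 2 := by gcongr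
    _ = _ := by ring

end Chebyshev

/-! ### Varopoulos-Carne bound: finite propagation and conclusion. -/

namespace Graph

variable (G : Graph)

lemma truncOp_eq_zero {F : Finset G.V} {f : G.V → ℝ} {y : G.V} {k : ℕ}
    (hf : ∀ z, k < G.dist z y → f z = 0) (z : G.V) (hz : k + 1 < G.dist z y) :
    G.truncOp F f z = 0 := by
  rw [truncOp_apply]
  refine Finset.sum_eq_zero fun b _ => ?_
  by_cases hb : b ∈ G.nbrs z
  · have h1 := G.dist_le_one (G.mem_nbrs.1 hb)
    have h2 := G.dist_triangle z b y
    rw [hf b (by omega), mul_zero]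
  · rw [G.p_eq_zero hb, zero_mul]

/-- T_k and U_{k-1} have degrees k and k - 1, and the operator enlarges supports by at most one. -/
lemma chebyshevPair_eq_zero {F : Finset G.V} {f : G.V → ℝ} {y : G.V}
    (hf : ∀ z, z ≠ y → f z = 0) (k : ℕ) :
    (∀ z, k < G.dist z y → (chebyshevPair (G.truncOp F) f k).1 z = 0) ∧
      ∀ z, k ≤ G.dist z y → (chebyshevPair (G.truncOp F) f k).2 z = 0 := by
  induction k with
  | zero =>
    refine ⟨fun z hz => hf z ?_, fun z _ => rfl⟩
    rintro rfl
    rw [dist_self] at hz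
    exact absurd hz (lt_irrefl _)
  | succ k ih =>
    obtain ⟨h1, h2⟩ := ih
    have h2' : ∀ z, k < G.dist z y → (chebyshevPair (G.truncOp F) f k).2 z = 0 :=
      fun z hz => h2 z hz.le
    have hQ1 := G.truncOp_eq_zero (F := F) h1
    -- For `k = 0` the second component is identically zero; there is no smaller radius to start
    -- from.
    have hQ2 : ∀ z, k < G.dist z y → G.truncOp F (chebyshevPair (G.truncOp F) f k).2 z = 0 := by
      rcases k with _ | k
      · intro z _
        simp [chebyshevPair]
      · exact fun z hz => G.truncOp_eq_zero (k := k) (fun z hz => h2 z hz) z hz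
    have hQQ := G.truncOp_eq_zero (F := F) hQ2
    constructor
    · intro z hz
      simp only [chebyshevPair, Pi.add_apply, Pi.sub_apply]
      rw [hQ1 z hz, h2' z (by omega), hQQ z hz]
      simp
    · intro z hz
      simp only [chebyshevPair, Pi.add_apply]
      rw [hQ2 z (by omega), h1 z (by omega), add_zero]

open Classical in
-- In `n` steps from `x` the walk does not leave the ball of radius `n`, so truncation to a set
-- containing this ball is invisible.
lemma truncOp_pow_apply {F : Finset G.V} (n : ℕ) {x y : G.V} (h : G.ball x n ⊆ F) :
    ((G.truncOp F) ^ n) (Pi.single y 1) x = G.pn n x y := by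
  induction n generalizing x with
  | zero => rw [pn_zero]; simp [Pi.single_apply]
  | succ n ih =>
    rw [pow_succ', Module.End.mul_apply, truncOp_apply, pn_succ]
    have hsub : G.nbrs x ⊆ F := fun z hz => by
      have := G.dist_le_one (G.mem_nbrs.1 hz)
      exact h (show G.dist x z ≤ n + 1 by omega)
    rw [← Finset.sum_subset hsub fun z _ hz => by rw [G.p_eq_zero hz, zero_mul]]
    refine Finset.sum_congr rfl fun z hz => ?_
    rw [ih ((G.ball_subset_ball (G.mem_nbrs.1 hz)).trans h)]

/-- The **Varopoulos-Carne bound**. -/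
theorem pn_le_varopoulos_carne (n : ℕ) (x y : G.V) :
    G.pn n x y ≤ 2 * √((G.deg y : ℝ) / G.deg x)
      * Real.exp (-(G.dist x y : ℝ) ^ 2 / (2 * n)) := by
  classical
  -- The vertex `y` is added so that the indicator of `y` has norm `deg y` even when `y` is outside
  -- the ball.
  let F : Finset G.V := insert y (G.ball_finite x n).toFinset
  have hF : G.ball x n ⊆ F := fun z hz => by simp [F, hz]
  have hx : x ∈ F := hF (G.mem_ball_self x n)
  have hy : y ∈ F := Finset.mem_insert_self _ _
  have hdx : (0 : ℝ) < G.deg x := by exact_mod_cast G.deg_pos x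
  have h := abs_apply_iterate_le (Q := G.truncOp F) (Pi.single y 1)
    (LinearMap.proj x) (M := √((G.deg y : ℝ) / G.deg x)) (d := G.dist x y) ?_ ?_ n
  · refine (le_abs_self _).trans ?_
    rw [← G.truncOp_pow_apply n hF]
    exact h
  · intro k
    rw [← Real.sqrt_sq_eq_abs]
    apply Real.sqrt_le_sqrt
    rw [le_div_iff₀ hdx, LinearMap.proj_apply]
    set u := (chebyshevPair (G.truncOp F) (Pi.single y 1) k).1
    calc u x ^ 2 * G.deg x = G.deg x * (u x * u x) := by ring
      _ ≤ G.degForm F u u := by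
          rw [degForm_apply]
          exact Finset.single_le_sum (f := fun a => (G.deg a : ℝ) * (u a * u a))
            (fun a _ => mul_nonneg (Nat.cast_nonneg _) (mul_self_nonneg _)) hx
      _ ≤ G.degForm F (Pi.single y 1) (Pi.single y 1) :=
          chebyshevPair_fst_le _ (G.degForm_comm F) (G.degForm_truncOp F)
            (G.degForm_truncOp_self_le F) k
      _ = G.deg y := by
          rw [degForm_apply, Finset.sum_eq_single_of_mem y hy]
          · simp
          · intro b _ hb
            simp [hb]
  · intro k hk
    exact (G.chebyshevPair_eq_zero (fun z hz => by simp [hz]) k).1 x hk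

end Graph

end RandomGraph
end

noncomputable section

namespace RandomGraph

/-! Local isomorphisms preserve distances and transition probabilities. -/

section LocalIso

variable {G H : Graph} {x : G.V} {y : H.V} {r : ℕ} (e : G.ball x r ≃ H.ball y r)

/-- A geodesic from the center stays in the ball, so it is transported by `e`. This fails for
distances between two arbitrary points of the ball. -/
lemma dist_ballEquiv_le (he : ∀ a b : G.ball x r, H.mult (e a) (e b) = G.mult a b)
    (hx : (e ⟨x, G.mem_ball_self x r⟩ : H.V) = y) (k : ℕ) (z : G.ball x r)
    (hz : G.dist x z ≤ k) : H.dist y (e z) ≤ k := by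
  induction k generalizing z with
  | zero =>
    have : z = ⟨x, G.mem_ball_self x r⟩ :=
      Subtype.ext (G.eq_of_dist_eq_zero (Nat.le_zero.1 hz)).symm
    rw [this, hx, H.dist_self]
  | succ k ih =>
    by_cases hzx : (z : G.V) = x
    · have : z = ⟨x, G.mem_ball_self x r⟩ := Subtype.ext hzx
      rw [this, hx, H.dist_self]
      exact Nat.zero_le _
    · rcases Nat.lt_or_ge k r with hk | hk
      · rw [G.dist_comm] at hz
        obtain ⟨w, h1, h2⟩ := G.exists_mult_pos_dist_le hz hzx
        rw [G.dist_comm] at h2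
        have hw : w ∈ G.ball x r := show G.dist x w ≤ r by omega
        have h3 := ih ⟨w, hw⟩ h2
        have h4 : H.dist (e ⟨w, hw⟩) (e z) ≤ 1 := H.dist_le_one (by rw [he, G.symm]; exact h1)
        have h5 := H.dist_triangle y (e ⟨w, hw⟩) (e z)
        omega
      · exact (show H.dist y (e z) ≤ r from (e z).2).trans (by omega)

lemma dist_ballEquiv (he : ∀ a b : G.ball x r, H.mult (e a) (e b) = G.mult a b)
    (hx : (e ⟨x, G.mem_ball_self x r⟩ : H.V) = y) (z : G.ball x r) :
    H.dist y (e z) = G.dist x z := by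
  refine le_antisymm (dist_ballEquiv_le e he hx _ z le_rfl) ?_
  have h := dist_ballEquiv_le e.symm (fun a b => by rw [← he]; simp) (by
    have : e ⟨x, G.mem_ball_self x r⟩ = ⟨y, H.mem_ball_self y r⟩ := Subtype.ext hx
    rw [← this, e.symm_apply_apply]) _ (e z) le_rfl
  simpa using h

lemma deg_ballEquiv (he : ∀ a b : G.ball x r, H.mult (e a) (e b) = G.mult a b)
    (hx : (e ⟨x, G.mem_ball_self x r⟩ : H.V) = y) (z : G.ball x r) (hz : G.dist x z < r) :
    H.deg (e z) = G.deg z := by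
  have key : ∀ (G : Graph) (x z : G.V), G.dist x z < r →
      (G.deg z : ℝ≥0∞) = ∑' a : G.ball x r, (G.mult z a : ℝ≥0∞) := by
    intro G x z hz
    rw [← G.tsum_mult]
    refine (tsum_subtype_eq_of_support_subset
      (f := fun a => (G.mult z a : ℝ≥0∞)) fun a ha => ?_).symm
    have h1 := G.dist_le_one (x := z) (y := a) (Nat.pos_of_ne_zero (by simpa using ha))
    have h2 := G.dist_triangle x z a
    exact show G.dist x a ≤ r by omega
  have h : (H.deg (e z) : ℝ≥0∞) = G.deg z := by
    rw [key G x z hz, key H y (e z) (by rwa [dist_ballEquiv e he hx]), ← e.tsum_eq]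
    simp only [he]
  exact_mod_cast h

/-- The `n` steps from `z` stay in the ball, and all but the last endpoint are strictly inside,
where degrees are preserved. -/
lemma pn_ballEquiv (he : ∀ a b : G.ball x r, H.mult (e a) (e b) = G.mult a b)
    (hx : (e ⟨x, G.mem_ball_self x r⟩ : H.V) = y) (n : ℕ) (z w : G.ball x r)
    (hz : G.dist x z + n ≤ r) : H.pn n (e z) (e w) = G.pn n z w := by
  classical
  induction n generalizing z with
  | zero =>
    rw [Graph.pn_zero, Graph.pn_zero]
    simp only [EmbeddingLike.apply_eq_iff_eq, Subtype.coe_inj]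
  | succ n ih =>
    have hp : ∀ a : G.ball x r, H.p (e z) (e a) = G.p z a := fun a => by
      rw [Graph.p, Graph.p, he, deg_ballEquiv e he hx z (by omega)]
    have key : ∀ (G : Graph) (x z w : G.V), G.dist x z < r →
        G.pn (n + 1) z w = ∑' a : G.ball x r, G.p z a * G.pn n a w := by
      intro G x z w hz
      rw [Graph.pn]
      refine (tsum_subtype_eq_of_support_subset
        (f := fun a => G.p z a * G.pn n a w) fun a ha => ?_).symm
      have hm : a ∈ G.nbrs z := by
        by_contra hm
        exact ha (by simp [G.p_eq_zero hm])
      have h1 := G.dist_le_one (G.mem_nbrs.1 hm)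
      have h2 := G.dist_triangle x z a
      exact show G.dist x a ≤ r by omega
    rw [key G x z w (by omega), key H y (e z) (e w) (by rw [dist_ballEquiv e he hx]; omega),
      ← e.tsum_eq]
    refine tsum_congr fun a => ?_
    rw [hp]
    by_cases hm : (a : G.V) ∈ G.nbrs z
    · rw [ih a]
      have h1 := G.dist_le_one (G.mem_nbrs.1 hm)
      have h2 := G.dist_triangle x z a
      omega
    · rw [G.p_eq_zero hm, zero_mul, zero_mul]

end LocalIso

namespace Graph

lemma dist_path_le (G : Graph) {ω : ℕ → G.V} (h : ∀ n, 0 < G.mult (ω n) (ω (n + 1)))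
    (m n : ℕ) : G.dist (ω m) (ω (m + n)) ≤ n := by
  induction n with
  | zero => simp [G.dist_self]
  | succ n ih =>
    have h1 := G.dist_triangle (ω m) (ω (m + n)) (ω (m + n + 1))
    have h2 := G.dist_le_one (h (m + n))
    exact h1.trans (by omega)

end Graph

lemma PathGraph.BallIso.refl (r : ℕ) (X : PathGraph) : X.BallIso r X :=
  ⟨Equiv.refl _, fun _ _ => rfl, fun _ _ _ => Iff.rfl⟩

lemma PathGraph.at_mem_ball (X : PathGraph) {n r : ℕ} (h : n ≤ r) :
    X.at_ n ∈ X.G.ball (X.at_ 0) r := by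
  have := X.G.dist_path_le X.path.2 0 n
  rw [zero_add] at this
  exact this.trans h

/-! ### Measurability and cocycle relations on isomorphism classes. -/

namespace PathClass

/-- The isomorphism class of a graph with a path. -/
def mk (X : PathGraph) : PathClass := Quotient.mk PathGraph.setoid X

lemma exists_mk (w : PathClass) : ∃ X, mk X = w := Quotient.exists_rep w

/-- Local observables are measurable. -/
lemma measurable_of_ballIso {α : Type*} [MeasurableSpace α] {φ : PathClass → α} (r : ℕ)
    (h : ∀ X Y : PathGraph, X.BallIso r Y →
      φ (mk X) = φ (mk Y)) :
    Measurable φ := by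
  intro S _
  apply IsOpen.measurableSet
  -- Every preimage is a union of basic open sets: a local observable is locally constant.
  have : φ ⁻¹' S = ⋃ X ∈ {X : PathGraph | φ (mk X) ∈ S},
      mk '' {Y | X.BallIso r Y} := by
    ext w
    rw [Set.mem_iUnion₂]
    constructor
    · intro hw
      obtain ⟨X, rfl⟩ := exists_mk w
      exact ⟨X, hw, X, PathGraph.BallIso.refl r X, rfl⟩
    · rintro ⟨X, hX, Y, hY, rfl⟩
      change φ _ ∈ S
      rw [← h X Y hY]
      exact hX
  rw [this]
  exact isOpen_biUnion fun X _ => TopologicalSpace.isOpen_generateFrom_of_mem ⟨X, r, rfl⟩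

lemma measurable_distAt (n : ℕ) : Measurable (distAt n) := by
  refine measurable_of_ballIso n ?_
  rintro X Y ⟨e, he, hp⟩
  have h0 := (hp 0 (Nat.zero_le _) ⟨_, X.at_mem_ball (Nat.zero_le n)⟩).1 rfl
  have hn := (hp n le_rfl ⟨_, X.at_mem_ball le_rfl⟩).1 rfl
  change X.G.dist (X.at_ 0) (X.at_ n) = Y.G.dist (Y.at_ 0) (Y.at_ n)
  rw [← hn]
  exact (dist_ballEquiv e he h0 ⟨_, X.at_mem_ball le_rfl⟩).symm

lemma measurable_pAt (n : ℕ) : Measurable (pAt n) := by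
  refine measurable_of_ballIso n ?_
  rintro X Y ⟨e, he, hp⟩
  have h0 := (hp 0 (Nat.zero_le _) ⟨_, X.at_mem_ball (Nat.zero_le n)⟩).1 rfl
  have hn := (hp n le_rfl ⟨_, X.at_mem_ball le_rfl⟩).1 rfl
  change X.G.pn n (X.at_ 0) (X.at_ n) = Y.G.pn n (Y.at_ 0) (Y.at_ n)
  have := pn_ballEquiv e he h0 n ⟨_, X.at_mem_ball (Nat.zero_le n)⟩ ⟨_, X.at_mem_ball le_rfl⟩
    (by simp [X.G.dist_self])
  rw [h0, hn] at this
  exact this.symm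

/-- The degree of the root. -/
def rootDeg : PathClass → ℕ :=
  Quotient.lift (fun X : PathGraph => X.G.deg (X.at_ 0)) (by
    rintro X Y ⟨e, h, hp⟩
    rw [← hp]
    unfold Graph.deg
    rw [← finsum_comp_equiv e]
    simp [h])

lemma measurable_rootDeg : Measurable rootDeg := by
  refine measurable_of_ballIso 1 ?_
  rintro X Y ⟨e, he, hp⟩
  have h0 := (hp 0 zero_le_one ⟨_, X.at_mem_ball zero_le_one⟩).1 rfl
  change X.G.deg (X.at_ 0) = Y.G.deg (Y.at_ 0)
  have := deg_ballEquiv e he h0 ⟨_, X.at_mem_ball zero_le_one⟩ (by simp [X.G.dist_self])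
  rw [h0] at this
  exact this.symm

lemma shift_iterate_mk (n : ℕ) (X : PathGraph) :
    shift^[n] (mk X) = mk
      ⟨X.G, ⟨fun m => X.at_ (n + m), fun m => X.path.2 (n + m)⟩⟩ := by
  induction n generalizing X with
  | zero => simp only [zero_add]; rfl
  | succ n ih =>
    change shift^[n] (mk X.shift) = _
    rw [ih]
    have h : ∀ m, X.at_ (n + m + 1) = X.at_ (n + 1 + m) := fun m => by
      rw [Nat.add_right_comm]
    exact congrArg mk (congrArg (PathGraph.mk X.G) (Subtype.ext (funext h)))

lemma distAt_add_le (m n : ℕ) (w : PathClass) :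
    distAt (m + n) w ≤ distAt m w + distAt n (shift^[m] w) := by
  obtain ⟨X, rfl⟩ := exists_mk w
  rw [shift_iterate_mk]
  exact X.G.dist_triangle (X.at_ 0) (X.at_ m) (X.at_ (m + n))

lemma distAt_zero (w : PathClass) : distAt 0 w = 0 := by
  obtain ⟨X, rfl⟩ := exists_mk w
  exact X.G.dist_self _

lemma distAt_le (n : ℕ) (w : PathClass) : distAt n w ≤ n := by
  obtain ⟨X, rfl⟩ := exists_mk w
  have := X.G.dist_path_le X.path.2 0 n
  rw [zero_add] at this
  exact this

lemma pAt_pos (n : ℕ) (w : PathClass) : 0 < pAt n w := by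
  obtain ⟨X, rfl⟩ := exists_mk w
  have := X.G.pn_pos_of_path X.path.2 0 n
  rw [zero_add] at this
  exact this

lemma pAt_le_one (n : ℕ) (w : PathClass) : pAt n w ≤ 1 := by
  obtain ⟨X, rfl⟩ := exists_mk w
  exact X.G.pn_le_one _ _ _

lemma pAt_zero (w : PathClass) : pAt 0 w = 1 := by
  classical
  obtain ⟨X, rfl⟩ := exists_mk w
  exact (X.G.pn_zero _ _).trans (if_pos rfl)

lemma pAt_mul_le (m n : ℕ) (w : PathClass) :
    pAt m w * pAt n (shift^[m] w) ≤ pAt (m + n) w := by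
  obtain ⟨X, rfl⟩ := exists_mk w
  rw [shift_iterate_mk]
  exact X.G.pn_mul_pn_le m n (X.at_ 0) (X.at_ m) (X.at_ (m + n))

lemma rootDeg_pos (w : PathClass) : 0 < rootDeg w := by
  obtain ⟨X, rfl⟩ := exists_mk w
  exact X.G.deg_pos _

lemma pAt_le_varopoulos_carne (n : ℕ) (w : PathClass) :
    pAt n w ≤ 2 * √((rootDeg (shift^[n] w) : ℝ) / rootDeg w)
      * Real.exp (-(distAt n w : ℝ) ^ 2 / (2 * n)) := by
  obtain ⟨X, rfl⟩ := exists_mk w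
  rw [shift_iterate_mk]
  exact X.G.pn_le_varopoulos_carne n (X.at_ 0) (X.at_ n)

end PathClass

/-! The distribution of the simple random walk. -/

namespace Graph

variable (G : Graph)

lemma countable_V [Nonempty G.V] : Countable G.V := by
  obtain ⟨x⟩ := ‹Nonempty G.V›
  rw [← Set.countable_univ_iff]
  refine (Set.countable_iUnion fun r => (G.ball_finite x r).countable).mono fun y _ => ?_
  exact Set.mem_iUnion.2 ⟨G.dist x y, le_refl (G.dist x y)⟩

lemma measurableEmbedding_pathSpace [Nonempty G.V] :
    MeasurableEmbedding (fun ω : G.PathSpace => (ω.1 : ℕ → G.V)) := by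
  have := G.countable_V
  refine ⟨fun ω ω' h => Subtype.ext h, comap_measurable _, ?_⟩
  rintro _ ⟨t, ht, rfl⟩
  have hS : MeasurableSet {ω : ℕ → G.V | ∀ n, 0 < G.mult (ω n) (ω (n + 1))} := by
    have : {ω : ℕ → G.V | ∀ n, 0 < G.mult (ω n) (ω (n + 1))}
        = ⋂ n, (fun ω : ℕ → G.V => (ω n, ω (n + 1))) ⁻¹' {a | 0 < G.mult a.1 a.2} := by
      ext ω; simp
    rw [this]
    exact MeasurableSet.iInter fun n =>
      ((measurable_pi_apply n).prodMk (measurable_pi_apply (n + 1))) (MeasurableSet.of_discrete)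
  convert ht.inter hS using 1
  ext ω
  constructor
  · rintro ⟨ω, h, rfl⟩
    exact ⟨h, ω.2⟩
  · rintro ⟨h, h'⟩
    exact ⟨⟨ω, h'⟩, h, rfl⟩

/-- An inequality suffices, as only upper bounds are needed and the total mass will come from
stationarity. Thus `seqLaw` need not be shown to charge only paths, nor `F` to be measurable. -/
lemma lintegral_walkLaw_le (x : G.V) (F : (ℕ → G.V) → ℝ≥0∞) :
    ∫⁻ ω : G.PathSpace, F ω.1 ∂(G.walkLaw x) ≤ ∫⁻ ω, F ω ∂(G.seqLaw x) := by
  have : Nonempty G.V := ⟨x⟩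
  have he := G.measurableEmbedding_pathSpace
  rw [← he.lintegral_map F, walkLaw, he.map_comap]
  exact setLIntegral_le_lintegral _ _

instance (x : G.V) : IsProbabilityMeasure (G.seqLaw x) := by
  unfold seqLaw; infer_instance

lemma seqLaw_ae_zero_eq (x : G.V) : ∀ᵐ ω ∂(G.seqLaw x), ω 0 = x := by
  have h := Kernel.traj_map_frestrictLe_apply (X := fun _ => G.V) (κ := G.stepKernel) 0 0
    (fun _ => x : ∀ _ : Finset.Iic 0, G.V)
  rw [Kernel.partialTraj_self, Kernel.id_apply] at h
  have hev : Measurable (fun h : (∀ _ : Finset.Iic 0, G.V) => h ⟨0, Finset.mem_Iic.2 le_rfl⟩) :=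
    measurable_pi_apply _
  have h2 : (G.seqLaw x).map (fun ω => ω 0) = Measure.dirac x := by
    have h3 := congrArg (fun m => Measure.map
      (fun h : (∀ _ : Finset.Iic 0, G.V) => h ⟨0, Finset.mem_Iic.2 le_rfl⟩) m) h
    rw [Measure.map_map hev (Preorder.measurable_frestrictLe 0), Measure.map_dirac' hev] at h3
    exact h3
  have h3 : ∀ᵐ y ∂((G.seqLaw x).map (fun ω => ω 0)), y = x := by
    rw [h2, ae_dirac_iff (MeasurableSet.of_discrete)]
  exact ae_of_ae_map (measurable_pi_apply 0).aemeasurable h3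

/-- The Markov property at time `n`: the trajectory is resampled from its restriction to times up to
`n`. -/
lemma seqLaw_succ (x y : G.V) (n : ℕ) :
    G.seqLaw x {ω | ω (n + 1) = y} = ∫⁻ ω, G.step (ω n) y ∂(G.seqLaw x) := by
  have h1 := Kernel.traj_comp_partialTraj (X := fun _ => G.V) (κ := G.stepKernel) (Nat.zero_le n)
  have hm : MeasurableSet {ω : ℕ → G.V | ω (n + 1) = y} :=
    (measurable_pi_apply (n + 1) : Measurable fun ω : ℕ → G.V => ω (n + 1))
      (MeasurableSet.of_discrete (s := {y}))
  rw [seqLaw, ← h1, Kernel.comp_apply' _ _ _ hm]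
  have h2 : ∀ h : (∀ _ : Finset.Iic n, G.V), Kernel.traj G.stepKernel n h
      {ω : ℕ → G.V | ω (n + 1) = y} = G.step (h ⟨n, Finset.mem_Iic.2 le_rfl⟩) y := by
    intro h
    have h3 := Kernel.map_traj_succ_self (X := fun _ => G.V) (κ := G.stepKernel) (a := n)
    have h4 := congrArg (fun k => k h {y}) h3
    rw [Kernel.map_apply' _ (measurable_pi_apply _) _ (MeasurableSet.of_discrete)] at h4
    refine h4.trans ?_
    exact PMF.toMeasure_apply_singleton _ _ (MeasurableSet.of_discrete)
  simp only [h2]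
  rw [h1, ← Kernel.traj_map_frestrictLe_apply, lintegral_map _ (Preorder.measurable_frestrictLe n)]
  · rfl
  · exact (measurable_from_top (f := fun a : G.V => G.step a y)).comp (measurable_pi_apply _)

/-- `pn` is defined by its first step while the law of the walk evolves by its last step; this is
the bridge. -/
lemma sum_pn_mul_p_le (n : ℕ) (x y : G.V) (F : Finset G.V) :
    ∑ z ∈ F, G.pn n x z * G.p z y ≤ G.pn (n + 1) x y := by
  classical
  induction n generalizing x with
  | zero =>
    rw [zero_add, pn_one]
    simp only [pn_zero, ite_mul, one_mul, zero_mul, Finset.sum_ite_eq]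
    split_ifs
    · exact le_rfl
    · exact G.p_nonneg _ _
  | succ n ih =>
    rw [pn_succ _ (n + 1)]
    simp only [pn_succ _ n x, Finset.sum_mul]
    rw [Finset.sum_comm]
    refine Finset.sum_le_sum fun w _ => ?_
    simp only [mul_assoc]
    rw [← Finset.mul_sum]
    exact mul_le_mul_of_nonneg_left (ih w) (G.p_nonneg _ _)

lemma seqLaw_le_pn (n : ℕ) (x y : G.V) :
    G.seqLaw x {ω | ω n = y} ≤ ENNReal.ofReal (G.pn n x y) := by
  classical
  induction n generalizing y with
  | zero =>
    rw [pn_zero]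
    split_ifs with h
    · rw [ENNReal.ofReal_one]; exact prob_le_one
    · refine le_of_eq_of_le (measure_mono_null (t := {ω | ¬ ω 0 = x}) ?_
        (G.seqLaw_ae_zero_eq x)) zero_le
      intro ω (h1 : ω 0 = y) (h2 : ω 0 = x)
      exact h (h2.symm.trans h1)
  | succ n ih =>
    have hm : Measurable fun ω : ℕ → G.V => ω n := measurable_pi_apply n
    rw [seqLaw_succ, ← lintegral_map (f := fun a => G.step a y)
      measurable_from_top hm]
    rw [← setLIntegral_eq_of_support_subset (s := (G.nbrs y : Set G.V)), lintegral_finset]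
    · calc ∑ z ∈ G.nbrs y, G.step z y * (G.seqLaw x).map (fun ω => ω n) {z}
          ≤ ∑ z ∈ G.nbrs y, ENNReal.ofReal (G.pn n x z * G.p z y) := by
            refine Finset.sum_le_sum fun z _ => ?_
            rw [Measure.map_apply hm (MeasurableSet.of_discrete), step_apply, mul_comm,
              ENNReal.ofReal_mul (G.pn_nonneg _ _ _)]
            exact mul_le_mul_left (ih z) _
        _ = ENNReal.ofReal (∑ z ∈ G.nbrs y, G.pn n x z * G.p z y) :=
            (ENNReal.ofReal_sum_of_nonneg fun z _ =>
              mul_nonneg (G.pn_nonneg _ _ _) (G.p_nonneg _ _)).symm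
        _ ≤ _ := ENNReal.ofReal_le_ofReal (G.sum_pn_mul_p_le n x y _)
    · intro z hz
      refine G.mem_nbrs.2 ?_
      by_contra h
      rw [Nat.pos_iff_ne_zero, not_not, G.symm] at h
      exact hz (by simp [step_apply, p, h])

/-- Union bound over the points of the ball where `pn n x` is at most `c`. -/
lemma seqLaw_dist_pn_le (n r : ℕ) (x : G.V) (c : ℝ) :
    G.seqLaw x {ω | G.dist (ω 0) (ω n) ≤ r ∧ G.pn n (ω 0) (ω n) ≤ c}
      ≤ ENNReal.ofReal ((G.ball x r).ncard * c) := by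
  classical
  let S : Finset G.V := {y ∈ (G.ball_finite x r).toFinset | G.pn n x y ≤ c}
  rcases lt_or_ge c 0 with hc | hc
  · refine le_of_eq_of_le ?_ zero_le
    convert measure_empty (μ := G.seqLaw x)
    ext ω
    simp only [Set.mem_empty_iff_false, iff_false]
    rintro ⟨-, h⟩
    exact absurd (G.pn_nonneg n (ω 0) (ω n)) (by linarith)
  calc G.seqLaw x {ω | G.dist (ω 0) (ω n) ≤ r ∧ G.pn n (ω 0) (ω n) ≤ c}
      ≤ G.seqLaw x (⋃ y ∈ S, {ω | ω n = y}) := by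
        refine measure_mono_ae ?_
        filter_upwards [G.seqLaw_ae_zero_eq x] with ω h0 h
        obtain ⟨h1, h2⟩ : G.dist (ω 0) (ω n) ≤ r ∧ G.pn n (ω 0) (ω n) ≤ c := h
        rw [h0] at h1 h2
        refine Set.mem_biUnion (x := ω n) ?_ rfl
        simp only [S, Finset.coe_filter, Set.Finite.mem_toFinset]
        exact ⟨h1, h2⟩
    _ ≤ ∑ y ∈ S, G.seqLaw x {ω | ω n = y} := measure_biUnion_finset_le _ _
    _ ≤ ∑ y ∈ S, ENNReal.ofReal c := by
        refine Finset.sum_le_sum fun y hy => (G.seqLaw_le_pn n x y).trans ?_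
        exact ENNReal.ofReal_le_ofReal (Finset.mem_filter.1 hy).2
    _ = ENNReal.ofReal (S.card * c) := by
        rw [Finset.sum_const, nsmul_eq_mul, ENNReal.ofReal_mul (Nat.cast_nonneg _),
          ENNReal.ofReal_natCast]
    _ ≤ _ := by
        apply ENNReal.ofReal_le_ofReal
        gcongr
        rw [Set.ncard_eq_toFinset_card _ (G.ball_finite x r)]
        exact Finset.card_filter_le _ _

/-- The entropy of one step is at most the logarithm of the number of points reached. -/
lemma sum_p_mul_neg_log_p_le (x : G.V) :
    ∑ y ∈ G.nbrs x, G.p x y * (-Real.log (G.p x y)) ≤ Real.log (G.nbrs x).card := by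
  obtain ⟨y₀, hy₀⟩ := G.pos x
  have hN : (0 : ℝ) < (G.nbrs x).card := by
    exact_mod_cast Finset.card_pos.2 ⟨y₀, G.mem_nbrs.2 hy₀⟩
  have h1 : ∀ y ∈ G.nbrs x, G.p x y * (-Real.log (G.p x y))
      ≤ G.p x y * Real.log (G.nbrs x).card + (1 / (G.nbrs x).card - G.p x y) := by
    intro y hy
    have hp := G.p_pos (G.mem_nbrs.1 hy)
    -- Gibbs' inequality against the uniform distribution on the neighbors.
    have h2 := Real.log_le_sub_one_of_pos (x := 1 / (G.p x y * (G.nbrs x).card)) (by positivity)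
    rw [one_div, Real.log_inv, Real.log_mul hp.ne' hN.ne'] at h2
    have h3 := mul_le_mul_of_nonneg_left h2 hp.le
    have h4 : G.p x y * ((G.p x y * (G.nbrs x).card)⁻¹ - 1)
        = 1 / (G.nbrs x).card - G.p x y := by field_simp
    linarith
  refine (Finset.sum_le_sum h1).trans (le_of_eq ?_)
  rw [Finset.sum_add_distrib, Finset.sum_sub_distrib, ← Finset.sum_mul, G.sum_p]
  simp [hN.ne']

lemma lintegral_neg_log_pn_one_le (x : G.V) :
    ∫⁻ ω, ENNReal.ofReal (-Real.log (G.pn 1 (ω 0) (ω 1))) ∂(G.seqLaw x)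
      ≤ ENNReal.ofReal (Real.log (G.ball x 1).ncard) := by
  have hm : Measurable fun ω : ℕ → G.V => ω 1 := measurable_pi_apply 1
  have hlog : ∀ y, 0 ≤ -Real.log (G.pn 1 x y) := fun y => by
    have := Real.log_nonpos (G.pn_nonneg 1 x y) (G.pn_le_one 1 x y)
    linarith
  have h0 : ∫⁻ ω, ENNReal.ofReal (-Real.log (G.pn 1 (ω 0) (ω 1))) ∂(G.seqLaw x)
      = ∫⁻ ω, ENNReal.ofReal (-Real.log (G.pn 1 x (ω 1))) ∂(G.seqLaw x) := by
    refine lintegral_congr_ae ?_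
    filter_upwards [G.seqLaw_ae_zero_eq x] with ω h
    rw [h]
  rw [h0, ← lintegral_map (f := fun a => ENNReal.ofReal (-Real.log (G.pn 1 x a)))
    measurable_from_top hm, ← setLIntegral_eq_of_support_subset (s := (G.nbrs x : Set G.V)),
    lintegral_finset]
  · calc ∑ z ∈ G.nbrs x, ENNReal.ofReal (-Real.log (G.pn 1 x z))
          * (G.seqLaw x).map (fun ω => ω 1) {z}
        ≤ ∑ z ∈ G.nbrs x, ENNReal.ofReal (G.p x z * -Real.log (G.p x z)) := by
          refine Finset.sum_le_sum fun z _ => ?_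
          rw [Measure.map_apply hm (MeasurableSet.of_discrete), mul_comm,
            ENNReal.ofReal_mul (G.p_nonneg _ _)]
          have := G.seqLaw_le_pn 1 x z
          rw [pn_one] at this ⊢
          exact mul_le_mul_left this _
      _ = ENNReal.ofReal (∑ z ∈ G.nbrs x, G.p x z * -Real.log (G.p x z)) :=
          (ENNReal.ofReal_sum_of_nonneg fun z _ =>
            mul_nonneg (G.p_nonneg _ _) (by have := hlog z; rwa [pn_one] at this)).symm
      _ ≤ _ := by
          apply ENNReal.ofReal_le_ofReal
          refine (G.sum_p_mul_neg_log_p_le x).trans ?_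
          obtain ⟨y₀, hy₀⟩ := G.pos x
          have hN : (0 : ℝ) < (G.nbrs x).card := by
            exact_mod_cast Finset.card_pos.2 ⟨y₀, G.mem_nbrs.2 hy₀⟩
          refine Real.log_le_log hN ?_
          rw [← Set.ncard_coe_finset]
          exact_mod_cast Set.ncard_le_ncard
            (fun y hy => G.dist_le_one (G.mem_nbrs.1 hy)) (G.ball_finite x 1)
  -- Outside of the neighbors `pn 1 x z = 0`, and the convention `Real.log 0 = 0` makes the
  -- integrand vanish.
  · intro z hz
    by_contra h
    refine hz ?_
    have : G.pn 1 x z = 0 := by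
      rw [pn_one]; exact G.p_eq_zero h
    simp [this]

lemma ncard_ball_pos (x : G.V) (r : ℕ) : 0 < (G.ball x r).ncard :=
  (Set.ncard_pos (G.ball_finite x r)).2 ⟨x, G.mem_ball_self x r⟩

lemma ncard_ball_mono (x : G.V) {r s : ℕ} (h : r ≤ s) : (G.ball x r).ncard ≤ (G.ball x s).ncard :=
  Set.ncard_le_ncard (fun _ (hy : G.dist x _ ≤ r) => hy.trans h) (G.ball_finite x s)

end Graph

namespace RootedClass

lemma ballCard_eq_out (r : ℕ) (g : RootedClass) :
    g.ballCard r = ((Quotient.out g).ball (Quotient.out g).root r).ncard := by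
  conv_lhs => rw [← Quotient.out_eq g]
  rfl

lemma ballCard_pos (r : ℕ) (g : RootedClass) : 0 < g.ballCard r := by
  rw [ballCard_eq_out]; exact Graph.ncard_ball_pos _ _ _

lemma ballCard_mono (g : RootedClass) {r s : ℕ} (h : r ≤ s) : g.ballCard r ≤ g.ballCard s := by
  rw [ballCard_eq_out, ballCard_eq_out]; exact Graph.ncard_ball_mono _ _ h

end RootedClass

lemma lintegral_classWalkLaw_le (g : RootedClass) (φ : PathClass → ℝ≥0∞)
    (F : (ℕ → (Quotient.out g).V) → ℝ≥0∞)
    (h : ∀ ω : (Quotient.out g).toGraph.PathSpace,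
      φ (PathClass.mk ⟨(Quotient.out g).toGraph, ω⟩) ≤ F ω.1) :
    ∫⁻ w, φ w ∂(classWalkLaw g)
      ≤ ∫⁻ ω, F ω ∂((Quotient.out g).toGraph.seqLaw (Quotient.out g).root) :=
  (lintegral_map_le _ _).trans ((lintegral_mono h).trans (Graph.lintegral_walkLaw_le _ _ F))

lemma classWalkLaw_le_one (g : RootedClass) (A : Set PathClass) : classWalkLaw g A ≤ 1 := by
  refine (measure_mono (Set.subset_univ A)).trans ?_
  rw [← lintegral_one]
  refine (lintegral_classWalkLaw_le g (fun _ => 1) (fun _ => 1) fun _ => le_rfl).trans ?_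
  simp

lemma classWalkLaw_distAt_pAt_le (g : RootedClass) (n r : ℕ) (c : ℝ) :
    classWalkLaw g {w | w.distAt n ≤ r ∧ w.pAt n ≤ c} ≤ ENNReal.ofReal (g.ballCard r * c) := by
  have hA : MeasurableSet {w : PathClass | w.distAt n ≤ r ∧ w.pAt n ≤ c} :=
    (measurableSet_le (PathClass.measurable_distAt n) measurable_const).inter
      (measurableSet_le (PathClass.measurable_pAt n) measurable_const)
  let X := Quotient.out g
  let S : Set (ℕ → X.V) := {ω | X.dist (ω 0) (ω n) ≤ r ∧ X.pn n (ω 0) (ω n) ≤ c}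
  rw [← lintegral_indicator_one hA, RootedClass.ballCard_eq_out]
  refine (lintegral_classWalkLaw_le g _ (S.indicator 1) fun ω => ?_).trans
    ((lintegral_indicator_one_le S).trans (X.toGraph.seqLaw_dist_pn_le n r X.root c))
  exact le_rfl

lemma lintegral_classWalkLaw_neg_log_pAt_one_le (g : RootedClass) :
    ∫⁻ w, ENNReal.ofReal (-Real.log (w.pAt 1)) ∂(classWalkLaw g)
      ≤ ENNReal.ofReal (Real.log (g.ballCard 1)) := by
  rw [RootedClass.ballCard_eq_out]
  exact (lintegral_classWalkLaw_le g _ (fun ω => ENNReal.ofReal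
    (-Real.log ((Quotient.out g).pn 1 (ω 0) (ω 1)))) fun ω => le_rfl).trans
    (Graph.lintegral_neg_log_pn_one_le _ _)

end RandomGraph
end

noncomputable section

/-! ### Existence of drift and entropy, and the two inequalities. -/

namespace RandomGraph

section Stationary

variable {μ : Measure RootedClass} [IsProbabilityMeasure μ]

/-- Otherwise `Measure.bind` takes its default value 0, and stationarity would force `μ = 0`. -/
lemma IsStationary.aemeasurable_classWalkLaw (hμ : IsStationary μ) :
    AEMeasurable classWalkLaw μ := by
  by_contra h
  have h0 : walkLaw μ = 0 := by
    rw [walkLaw, Measure.bind, Measure.map_of_not_aemeasurable h, Measure.join_zero]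
  rw [IsStationary, h0, Measure.map_zero] at hμ
  exact IsProbabilityMeasure.ne_zero μ hμ.symm

lemma IsStationary.isProbabilityMeasure_walkLaw (hμ : IsStationary μ) :
    IsProbabilityMeasure (walkLaw μ) := by
  have hm : AEMeasurable (fun w : PathClass => w.shift.rooted) (walkLaw μ) := by
    by_contra h
    rw [IsStationary, Measure.map_of_not_aemeasurable h] at hμ
    exact IsProbabilityMeasure.ne_zero μ hμ.symm
  refine ⟨?_⟩
  have h1 := congrArg (fun m => m Set.univ) hμ
  simp only [measure_univ] at h1
  rwa [Measure.map_apply_of_aemeasurable hm MeasurableSet.univ, Set.preimage_univ] at h1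

lemma walkLaw_apply (hμ : IsStationary μ) {A : Set PathClass} (hA : MeasurableSet A) :
    walkLaw μ A = ∫⁻ g, classWalkLaw g A ∂μ :=
  Measure.bind_apply hA hμ.aemeasurable_classWalkLaw

lemma lintegral_walkLaw (hμ : IsStationary μ) {f : PathClass → ℝ≥0∞} (hf : Measurable f) :
    ∫⁻ w, f w ∂(walkLaw μ) = ∫⁻ g, ∫⁻ w, f w ∂(classWalkLaw g) ∂μ :=
  Measure.lintegral_bind hμ.aemeasurable_classWalkLaw hf.aemeasurable

end Stationary

lemma PathClass.neg_log_pAt_nonneg (n : ℕ) (w : PathClass) : 0 ≤ -Real.log (w.pAt n) := by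
  have := Real.log_nonpos (PathClass.pAt_pos n w).le (PathClass.pAt_le_one n w)
  linarith

lemma PathClass.measurable_neg_log_pAt (n : ℕ) :
    Measurable fun w : PathClass => -Real.log (w.pAt n) :=
  (Real.measurable_log.comp (PathClass.measurable_pAt n)).neg

lemma PathClass.neg_log_pAt_add_le (m n : ℕ) (w : PathClass) :
    -Real.log (w.pAt (m + n))
      ≤ -Real.log (w.pAt m) + -Real.log ((PathClass.shift^[m] w).pAt n) := by
  have h1 := PathClass.pAt_pos m w
  have h2 := PathClass.pAt_pos n (PathClass.shift^[m] w)
  have h := Real.log_le_log (mul_pos h1 h2) (PathClass.pAt_mul_le m n w)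
  rw [Real.log_mul h1.ne' h2.ne'] at h
  linarith

lemma lintegral_log_ballCard_one_lt_top {μ : Measure RootedClass} (hv : volumeGrowth μ < ⊤) :
    ∫⁻ g, ENNReal.ofReal (Real.log (g.ballCard 1)) ∂μ < ⊤ := by
  obtain ⟨r, hr, hr1⟩ := ((frequently_lt_of_liminf_lt (by isBoundedDefault)
    hv).and_eventually (eventually_ge_atTop 1)).exists
  have h1 : ∫⁻ g, ENNReal.ofReal (Real.log (g.ballCard r)) ∂μ < ⊤ := by
    rw [lt_top_iff_ne_top]
    intro h
    rw [h, ENNReal.top_div_of_ne_top (ENNReal.natCast_ne_top r)] at hr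
    exact lt_irrefl _ hr
  refine (lintegral_mono fun g => ENNReal.ofReal_le_ofReal ?_).trans_lt h1
  exact Real.log_le_log (by exact_mod_cast RootedClass.ballCard_pos 1 g)
    (by exact_mod_cast RootedClass.ballCard_mono g hr1)

lemma integrable_neg_log_pAt_one {μ : Measure RootedClass} [IsProbabilityMeasure μ]
    (hμ : IsStationary μ) (hv : volumeGrowth μ < ⊤) :
    Integrable (fun w : PathClass => -Real.log (w.pAt 1)) (walkLaw μ) := by
  refine ⟨(PathClass.measurable_neg_log_pAt 1).aestronglyMeasurable, ?_⟩
  rw [hasFiniteIntegral_iff_ofReal (Eventually.of_forall (PathClass.neg_log_pAt_nonneg 1)),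
    lintegral_walkLaw hμ (PathClass.measurable_neg_log_pAt 1).ennreal_ofReal]
  exact (lintegral_mono lintegral_classWalkLaw_neg_log_pAt_one_le).trans_lt
    (lintegral_log_ballCard_one_lt_top hv)

theorem IsErgodicStationary.exists_isLinearDrift {μ : Measure RootedClass}
    [IsProbabilityMeasure μ] (hμ : IsErgodicStationary μ) : ∃ l, 0 ≤ l ∧ IsLinearDrift μ l := by
  have := hμ.stationary.isProbabilityMeasure_walkLaw
  have hm : ∀ n, Measurable fun w : PathClass => (w.distAt n : ℝ) := fun n =>
    measurable_from_top.comp (PathClass.measurable_distAt n)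
  obtain ⟨l, hl, h1, h2⟩ := ErgodicTheory.exists_tendsto_subadditive hμ.ergodic
    (f := fun n w => (w.distAt n : ℝ)) hm (fun n w => Nat.cast_nonneg _)
    (fun w => by rw [PathClass.distAt_zero, Nat.cast_zero])
    (Integrable.of_bound (hm 1).aestronglyMeasurable 1 (Eventually.of_forall fun w => by
      rw [Real.norm_of_nonneg (Nat.cast_nonneg _)]
      exact_mod_cast PathClass.distAt_le 1 w))
    (fun m n w => by exact_mod_cast PathClass.distAt_add_le m n w)
  exact ⟨l, hl, h1, h2⟩

theorem IsErgodicStationary.exists_isEntropy {μ : Measure RootedClass}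
    [IsProbabilityMeasure μ] (hμ : IsErgodicStationary μ) (hv : volumeGrowth μ < ⊤) :
    ∃ h, 0 ≤ h ∧ IsEntropy μ h := by
  have := hμ.stationary.isProbabilityMeasure_walkLaw
  obtain ⟨h, h0, h1, h2⟩ := ErgodicTheory.exists_tendsto_subadditive hμ.ergodic
    (f := fun n w => -Real.log (w.pAt n)) PathClass.measurable_neg_log_pAt
    PathClass.neg_log_pAt_nonneg
    (fun w => by rw [PathClass.pAt_zero, Real.log_one, neg_zero])
    (integrable_neg_log_pAt_one hμ.stationary hv) PathClass.neg_log_pAt_add_le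
  exact ⟨h, h0, h1, h2⟩

lemma PathClass.half_sq_le (n : ℕ) (w : PathClass) :
    (w.distAt n : ℝ) ^ 2 / (2 * n) ≤
      -Real.log (w.pAt n) + Real.log 2 + Real.log (PathClass.shift^[n] w).rootDeg / 2 := by
  have hp := PathClass.pAt_pos n w
  have hd : (1 : ℝ) ≤ w.rootDeg := by exact_mod_cast PathClass.rootDeg_pos w
  have hd' : (0 : ℝ) < (PathClass.shift^[n] w).rootDeg := by
    exact_mod_cast PathClass.rootDeg_pos _
  have hs : √(((PathClass.shift^[n] w).rootDeg : ℝ) / w.rootDeg)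
      ≤ √((PathClass.shift^[n] w).rootDeg : ℝ) :=
    Real.sqrt_le_sqrt (div_le_self hd'.le hd)
  have hb : w.pAt n ≤ 2 * √((PathClass.shift^[n] w).rootDeg : ℝ)
      * Real.exp (-(w.distAt n : ℝ) ^ 2 / (2 * n)) :=
    (PathClass.pAt_le_varopoulos_carne n w).trans (by gcongr)
  have hlog := Real.log_le_log hp hb
  rw [Real.log_mul (by positivity) (Real.exp_pos _).ne', Real.log_mul two_ne_zero (by positivity),
    Real.log_exp, Real.log_sqrt hd'.le, neg_div] at hlog
  linarith

theorem half_sq_drift_le_entropy {μ : Measure RootedClass} [IsProbabilityMeasure μ]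
    (hμ : IsErgodicStationary μ) {l h : ℝ} (hl : IsLinearDrift μ l) (hh : IsEntropy μ h) :
    1 / 2 * l ^ 2 ≤ h := by
  have := hμ.stationary.isProbabilityMeasure_walkLaw
  by_contra! hlt
  obtain ⟨ε, hε, hεh⟩ : ∃ ε : ℝ, 0 < ε ∧ h + ε < 1 / 2 * l ^ 2 :=
    ⟨(1 / 2 * l ^ 2 - h) / 2, by linarith, by linarith⟩
  -- The contradiction: the probability of `B n` tends to 0, as the root degree is finite, whereas
  -- its preimage under the `n`-th shift has probability tending to 1 by `half_sq_le`. Invariance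
  -- makes the two equal.
  let B : ℕ → Set PathClass := fun n => {w | n * ε < Real.log w.rootDeg / 2}
  have hBm : ∀ n, MeasurableSet (B n) := fun n =>
    measurableSet_lt measurable_const ((Real.measurable_log.comp
      (measurable_from_top.comp PathClass.measurable_rootDeg)).div_const 2)
  have h0 : Tendsto (fun n => walkLaw μ (B n)) atTop (𝓝 (walkLaw μ ∅)) := by
    refine tendsto_measure_of_ae_tendsto_indicator_of_isFiniteMeasure atTop
      MeasurableSet.empty hBm (Eventually.of_forall fun w => ?_)
    obtain ⟨N, hN⟩ := exists_nat_ge (Real.log w.rootDeg / 2 / ε)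
    filter_upwards [eventually_ge_atTop N] with n hn
    simp only [B, Set.mem_ofPred_eq, Set.mem_empty_iff_false, iff_false, not_lt]
    have hn' : (N : ℝ) ≤ n := by exact_mod_cast hn
    rw [div_le_iff₀ hε] at hN
    exact hN.trans (by gcongr)
  have h1 : Tendsto (fun n => walkLaw μ (PathClass.shift^[n] ⁻¹' B n)) atTop
      (𝓝 (walkLaw μ Set.univ)) := by
    refine tendsto_measure_of_ae_tendsto_indicator_of_isFiniteMeasure atTop
      MeasurableSet.univ (fun n => (hμ.ergodic.measurable.iterate n) (hBm n)) ?_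
    filter_upwards [hl.1, hh.1] with w w1 w2
    have w3 : Tendsto (fun n : ℕ => 1 / 2 * ((w.distAt n : ℝ) / n) ^ 2
        - -Real.log (w.pAt n) / n - Real.log 2 / n) atTop (𝓝 (1 / 2 * l ^ 2 - h - 0)) :=
      (((w1.pow 2).const_mul (1 / 2)).sub w2).sub (tendsto_const_div_atTop_nhds_zero_nat _)
    filter_upwards [w3.eventually_const_lt (show ε < 1 / 2 * l ^ 2 - h - 0 by linarith),
      eventually_ge_atTop 1] with n hn hn1
    simp only [Set.mem_univ, iff_true]
    have hn' : (0 : ℝ) < n := by exact_mod_cast hn1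
    have h2 := PathClass.half_sq_le n w
    have h3 : 1 / 2 * ((w.distAt n : ℝ) / n) ^ 2 - -Real.log (w.pAt n) / n - Real.log 2 / n
        = ((w.distAt n : ℝ) ^ 2 / (2 * n) + Real.log (w.pAt n) - Real.log 2) / n := by
      field_simp
      ring
    rw [h3, lt_div_iff₀ hn'] at hn
    change n * ε < Real.log (PathClass.shift^[n] w).rootDeg / 2
    linarith
  have h2 : ∀ n, walkLaw μ (PathClass.shift^[n] ⁻¹' B n) = walkLaw μ (B n) := fun n =>
    (hμ.ergodic.toMeasurePreserving.iterate n).measure_preimage (hBm n).nullMeasurableSet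
  simp only [h2] at h1
  have h3 := tendsto_nhds_unique h0 h1
  simp at h3

/-- If the walk is at distance at most `r` with transition probability at most `exp (-s)` with
high probability, then the ball of radius `r` has typically about `exp s` points. -/
lemma two_mul_walkLaw_le {μ : Measure RootedClass} [IsProbabilityMeasure μ] (hμ : IsStationary μ)
    (n r : ℕ) (s : ℝ) :
    2 * ENNReal.ofReal (s - Real.log 2)
        * walkLaw μ {w | w.distAt n ≤ r ∧ w.pAt n ≤ Real.exp (-s)} ≤
      ENNReal.ofReal (s - Real.log 2)
        + ∫⁻ g, ENNReal.ofReal (Real.log (g.ballCard r)) ∂μ := by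
  set A : Set PathClass := {w | w.distAt n ≤ r ∧ w.pAt n ≤ Real.exp (-s)}
  set K := ENNReal.ofReal (s - Real.log 2) with hK
  have hA : MeasurableSet A :=
    (measurableSet_le (PathClass.measurable_distAt n) measurable_const).inter
      (measurableSet_le (PathClass.measurable_pAt n) measurable_const)
  -- Either the ball has at least `exp s / 2` points and both terms on the right are at least `K`,
  -- or the conditional probability of `A` is at most 1/2.
  have key : ∀ g, 2 * K * classWalkLaw g A ≤ K + ENNReal.ofReal (Real.log (g.ballCard r)) := by
    intro g
    have hN : (0 : ℝ) < g.ballCard r := by exact_mod_cast RootedClass.ballCard_pos r g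
    rcases le_or_gt (s - Real.log 2) (Real.log (g.ballCard r)) with h | h
    · calc 2 * K * classWalkLaw g A ≤ 2 * K * 1 := by gcongr; exact classWalkLaw_le_one g A
        _ = K + K := by rw [mul_one, two_mul]
        _ ≤ _ := by gcongr; exact ENNReal.ofReal_le_ofReal h
    · have h1 : (g.ballCard r : ℝ) * Real.exp (-s) ≤ 1 / 2 := by
        have h2 := (Real.log_lt_iff_lt_exp hN).1 h
        rw [Real.exp_sub, Real.exp_log two_pos] at h2
        calc (g.ballCard r : ℝ) * Real.exp (-s) ≤ Real.exp s / 2 * Real.exp (-s) := by gcongr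
          _ = 1 / 2 := by rw [div_mul_eq_mul_div, ← Real.exp_add]; simp
      have h2 : classWalkLaw g A ≤ 2⁻¹ := by
        refine (classWalkLaw_distAt_pAt_le g n r _).trans
          ((ENNReal.ofReal_le_ofReal h1).trans (le_of_eq ?_))
        rw [one_div, ENNReal.ofReal_inv_of_pos two_pos]
        simp
      calc 2 * K * classWalkLaw g A ≤ 2 * K * 2⁻¹ := by gcongr
        _ = K := by
          rw [mul_comm 2 K, mul_assoc, ENNReal.mul_inv_cancel two_ne_zero ENNReal.ofNat_ne_top,
            mul_one]
        _ ≤ _ := le_self_add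
  have hKtop : 2 * K ≠ ⊤ := ENNReal.mul_ne_top ENNReal.ofNat_ne_top ENNReal.ofReal_ne_top
  rw [walkLaw_apply hμ hA, ← lintegral_const_mul' _ _ hKtop]
  refine (lintegral_mono key).trans ?_
  rw [lintegral_add_left measurable_const]
  simp

lemma le_drift_mul_volumeGrowth {μ : Measure RootedClass} [IsProbabilityMeasure μ]
    (hμ : IsStationary μ) (hv : volumeGrowth μ < ⊤) {l h : ℝ} (hl0 : 0 ≤ l)
    (hl : IsLinearDrift μ l) (hh : IsEntropy μ h) {ε : ℝ} (hε : 0 < ε) :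
    h - 2 * ε ≤ (l + ε) * (volumeGrowth μ).toReal := by
  have := hμ.isProbabilityMeasure_walkLaw
  have hD : 0 < l + ε := by linarith
  rcases le_or_gt (h - 2 * ε) 0 with hc' | hc'
  · exact hc'.trans (mul_nonneg hD.le ENNReal.toReal_nonneg)
  set c := h - ε with hc
  have hcpos : 0 < c := by linarith
  set I : ℕ → ℝ≥0∞ := fun r => ∫⁻ g, ENNReal.ofReal (Real.log (g.ballCard r)) ∂μ with hI
  let A : ℕ → Set PathClass := fun n =>
    {w | w.distAt n ≤ ⌊(l + ε) * n⌋₊ ∧ w.pAt n ≤ Real.exp (-(c * n))}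
  have hAm : ∀ n, MeasurableSet (A n) := fun n =>
    (measurableSet_le (PathClass.measurable_distAt n) measurable_const).inter
      (measurableSet_le (PathClass.measurable_pAt n) measurable_const)
  have hA1 : Tendsto (fun n => walkLaw μ (A n)) atTop (𝓝 (walkLaw μ Set.univ)) := by
    refine tendsto_measure_of_ae_tendsto_indicator_of_isFiniteMeasure atTop
      MeasurableSet.univ hAm ?_
    filter_upwards [hl.1, hh.1] with w w1 w2
    filter_upwards [w1.eventually_lt_const (show l < l + ε by linarith),
      w2.eventually_const_lt (show c < h by linarith), eventually_ge_atTop 1] with n e1 e2 hn1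
    have hn' : (0 : ℝ) < n := by exact_mod_cast hn1
    rw [div_lt_iff₀ hn'] at e1
    rw [lt_div_iff₀ hn'] at e2
    simp only [Set.mem_univ, iff_true]
    refine ⟨Nat.le_floor e1.le, ?_⟩
    rw [← Real.log_le_iff_le_exp (PathClass.pAt_pos n w)]
    linarith
  rw [measure_univ] at hA1
  have hAr : Tendsto (fun n => (walkLaw μ (A n)).toReal) atTop (𝓝 1) := by
    rw [← ENNReal.toReal_one]
    exact (ENNReal.tendsto_toReal ENNReal.one_ne_top).comp hA1
  -- `two_mul_walkLaw_le` gives a lower bound `(c * n - log 2) * (2 * P(A n) - 1)` for `I r`, with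
  -- `P(A n)` close to 1.
  have hlarge : ∀ᶠ n : ℕ in atTop, ∀ r : ℕ, ⌊(l + ε) * n⌋₊ ≤ r →
      ENNReal.ofReal ((h - 2 * ε) * n) ≤ I r := by
    have t1 : Tendsto (fun n : ℕ => (c - Real.log 2 / n) * (2 * (walkLaw μ (A n)).toReal - 1))
        atTop (𝓝 ((c - 0) * (2 * 1 - 1))) :=
      ((tendsto_const_div_atTop_nhds_zero_nat _).const_sub c).mul
        ((hAr.const_mul 2).sub_const 1)
    obtain ⟨M, hM⟩ := exists_nat_ge (Real.log 2 / c)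
    filter_upwards [t1.eventually_const_lt
      (show h - 2 * ε < (c - 0) * (2 * 1 - 1) by linarith), eventually_ge_atTop M,
      eventually_ge_atTop 1] with n e1 e2 hn1 r hr
    have hn' : (0 : ℝ) < n := by exact_mod_cast hn1
    have e2' : (M : ℝ) ≤ n := by exact_mod_cast e2
    have hs : Real.log 2 ≤ c * n := by
      rw [div_le_iff₀ hcpos] at hM
      nlinarith
    rcases eq_or_ne (I r) ⊤ with htop | htop
    · rw [htop]; exact le_top
    have h1 := two_mul_walkLaw_le hμ n r (c * n)
    have h2 : walkLaw μ (A n) ≤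
        walkLaw μ {w | w.distAt n ≤ r ∧ w.pAt n ≤ Real.exp (-(c * n))} :=
      measure_mono fun w hw => ⟨hw.1.trans hr, hw.2⟩
    have h3 : 2 * ENNReal.ofReal (c * n - Real.log 2) * walkLaw μ (A n)
        ≤ ENNReal.ofReal (c * n - Real.log 2) + I r := le_trans (by gcongr) h1
    have h4 := ENNReal.toReal_mono (ENNReal.add_ne_top.2 ⟨ENNReal.ofReal_ne_top, htop⟩) h3
    rw [ENNReal.toReal_add ENNReal.ofReal_ne_top htop, ENNReal.toReal_mul, ENNReal.toReal_mul,
      ENNReal.toReal_ofReal (by linarith), ENNReal.toReal_ofNat] at h4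
    apply ENNReal.ofReal_le_of_le_toReal
    have h5 : (c * n - Real.log 2) * (2 * (walkLaw μ (A n)).toReal - 1)
        = (c - Real.log 2 / n) * (2 * (walkLaw μ (A n)).toReal - 1) * n := by
      field_simp
    have h6 : (h - 2 * ε) * n
        ≤ (c - Real.log 2 / n) * (2 * (walkLaw μ (A n)).toReal - 1) * n := by gcongr
    linarith
  -- The liminf runs over all radii, so `n` is chosen from `r`: the largest integer with `(l + ε) *
  -- n ≤ r`. Using `l + ε` also covers zero drift.
  have hfl : Tendsto (fun r : ℕ => ⌊(r : ℝ) / (l + ε)⌋₊) atTop atTop :=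
    tendsto_nat_floor_atTop.comp
      (Tendsto.atTop_div_const hD tendsto_natCast_atTop_atTop)
  have hlim : Tendsto (fun r : ℕ => ENNReal.ofReal
      ((h - 2 * ε) * (⌊(l + ε)⁻¹ * (r : ℝ)⌋₊ / (r : ℝ)))) atTop
      (𝓝 (ENNReal.ofReal ((h - 2 * ε) * (l + ε)⁻¹))) :=
    ENNReal.tendsto_ofReal (((tendsto_nat_floor_mul_div_atTop
      (inv_nonneg.2 hD.le)).comp tendsto_natCast_atTop_atTop).const_mul _)
  have hle : ENNReal.ofReal ((h - 2 * ε) * (l + ε)⁻¹) ≤ volumeGrowth μ := by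
    rw [← hlim.liminf_eq, volumeGrowth]
    refine liminf_le_liminf ?_
    filter_upwards [hfl.eventually hlarge, eventually_ge_atTop 1] with r e1 hr1
    have hr' : (0 : ℝ) < r := by exact_mod_cast hr1
    have e2 := e1 r (by
      refine Nat.floor_le_of_le ?_
      calc (l + ε) * ⌊(r : ℝ) / (l + ε)⌋₊ ≤ (l + ε) * ((r : ℝ) / (l + ε)) := by
            gcongr
            exact Nat.floor_le (by positivity)
        _ = r := by field_simp)
    rw [← mul_div_assoc, ENNReal.ofReal_div_of_pos hr', ENNReal.ofReal_natCast,
      inv_mul_eq_div]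
    gcongr
  have h7 := (ENNReal.ofReal_le_iff_le_toReal hv.ne).1 hle
  rw [← div_eq_mul_inv, div_le_iff₀ hD] at h7
  linarith

theorem entropy_le_drift_mul_volumeGrowth {μ : Measure RootedClass} [IsProbabilityMeasure μ]
    (hμ : IsStationary μ) (hv : volumeGrowth μ < ⊤) {l h : ℝ} (hl0 : 0 ≤ l)
    (hl : IsLinearDrift μ l) (hh : IsEntropy μ h) : h ≤ l * (volumeGrowth μ).toReal := by
  refine le_of_forall_pos_le_add fun η hη => ?_
  have hv0 : 0 ≤ (volumeGrowth μ).toReal := ENNReal.toReal_nonneg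
  have hpos : 0 < 2 + (volumeGrowth μ).toReal := by linarith
  -- The total error `2 * ε + ε * v` equals `η` for this `ε`.
  have h1 := le_drift_mul_volumeGrowth hμ hv hl0 hl hh (div_pos hη hpos)
  have h2 : η / (2 + (volumeGrowth μ).toReal) * (2 + (volumeGrowth μ).toReal) = η :=
    div_mul_cancel₀ _ hpos.ne'
  linarith

end RandomGraph

end

theorem mainTheorem7 (μ : MeasureTheory.Measure RandomGraph.RootedClass)
    [MeasureTheory.IsProbabilityMeasure μ]
    (hμ : RandomGraph.IsErgodicStationary μ)
    (hv : RandomGraph.volumeGrowth μ < ⊤) :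
    ∃ l h : ℝ, RandomGraph.IsLinearDrift μ l ∧ RandomGraph.IsEntropy μ h ∧
      1 / 2 * l ^ 2 ≤ h ∧ h ≤ l * (RandomGraph.volumeGrowth μ).toReal := by
  obtain ⟨l, hl0, hl⟩ := hμ.exists_isLinearDrift
  obtain ⟨h, -, hh⟩ := hμ.exists_isEntropy hv
  exact ⟨l, h, hl, hh, RandomGraph.half_sq_drift_le_entropy hμ hl hh,
    RandomGraph.entropy_le_drift_mul_volumeGrowth hμ.stationary hv hl0 hl hh⟩
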